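/- A transmitter with a buffer of size $Q$ works in time slots. The number of arrivals $a[n]\in\{0,\dots,A\}$, $A\ge 1$, is a homogeneous irreducible Markov chain with transition probabilities $\gamma_{a,a'}$, stationary distribution $\phi$ and mean $\alpha=\sum_a a\phi_a$. The channel state $h[n]\in\{h_1,\dots,h_L\}\subset\mathbb{C}$, $0<|h_1|<\dots<|h_L|$, is i.i.d. with $\Pr\{h[n]=h_\iota\}=\eta_\iota$ and independent of the arrivals. Transmitting $s\in\{0,\dots,S\}$ packets in channel state $h_\iota$ costs power $P_{h_\iota}(s)$, where $P_{h_\iota}(0)=0$ and $P_{h_\iota}$ is nondecreasing and convex on $\{0,\dots,S\}$. Assume $A\le S$ and $A\le Q$. In queue state $q$ the feasible rates are $\mathcal S(q)=\{s:\max\{q-Q+A,0\}\le s\le\min\{q,S\}\}$, and the queue evolves as $q[n+1]=\min\{\max\{q[n]-s[n],0\}+a[n+1],Q\}$. A policy $\boldsymbol F=\{f_{q,a,\iota}^{s}\}$ gives, for each state $(q,a,\iota)$ with $0\le q\le Q$, $0\le a\le A$, $1\le\iota\le L$, a probability distribution $(f_{q,a,\iota}^{s})_{0\le s\le S}$ of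 the rate supported in $\mathcal S(q)$; put $f_{q,a,\iota}^{S+1}=0$. For an initial state $(q_0,a_0,h_{\iota_0})$ at time $0$ let $$P_{\boldsymbol F}=\lim_{N\to\infty}\frac1N\,\mathbb E\sum_{n=1}^N P_{h[n]}(s[n]),\qquad D_{\boldsymbol F}=\lim_{N\to\infty}\frac1N\,\mathbb E\,\frac1\alpha\sum_{n=1}^N q[n].$$ Let $P_{\rm th}\in\mathbb R$ be such that $P_{\boldsymbol F}\le P_{\rm th}$ for some policy $\boldsymbol F$ and some initial state. Then there is a policy $\boldsymbol F^\ast$ which, from every initial state, minimizes $D_{\boldsymbol F}$ over all policies $\boldsymbol F$ with $P_{\boldsymbol F}\le P_{\rm th}$ (and itself satisfies $P_{\boldsymbol F^\ast}\le P_{\rm th}$), and which is threshold-based in the following sense. There are integers $q_{\boldsymbol F^\ast}(s,a,\iota)$, $0\le s\le S$, $0\le a\le A$, $1\le\iota\le L$, with $0\le q_{\boldsymbol F^\ast}(0,a,\iota)\le\dots\le q_{\boldsymbol F^\ast}(S,a,\iota)\le Q$ for all $a,\iota$, and $s^\ast\in\{0,\dots,S\}$, $a^\ast\in\{0,\dots,A\}$,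 $\iota^\ast\in\{1,\dots,L\}$ such that, with $q_{\boldsymbol F^\ast}(-1,a,\iota)=-1$ and for $0\le q\le Q$, $0\le s\le S$, $$\begin{cases}{f^\ast}_{q,a,\iota}^{s}=1 & \text{if } q_{\boldsymbol F^\ast}(s-1,a,\iota)<q\le q_{\boldsymbol F^\ast}(s,a,\iota)\text{ and }(a\ne a^\ast\text{ or }s\ne s^\ast\text{ or }\iota\ne\iota^\ast),\\ {f^\ast}_{q,a,\iota}^{s}=1 & \text{if } q_{\boldsymbol F^\ast}(s-1,a,\iota)<q<q_{\boldsymbol F^\ast}(s,a,\iota)\text{ and }(s,a,\iota)=(s^\ast,a^\ast,\iota^\ast),\\ {f^\ast}_{q,a,\iota}^{s}+{f^\ast}_{q,a,\iota}^{s+1}=1 & \text{if } q=q_{\boldsymbol F^\ast}(s,a,\iota)\text{ and }(s,a,\iota)=(s^\ast,a^\ast,\iota^\ast),\\ {f^\ast}_{q,a,\iota}^{s}=0 & \text{for every }(q,a,\iota,s)\text{ whose }f^\ast\text{ does not occur in the three lines above.}\end{cases}$$ So $\boldsymbol F^\ast$ is deterministic except possibly in the single state $(q_{\boldsymbol F^\ast}(s^\ast,a^\ast,\iota^\ast),a^\ast,\iota^\ast)$,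 where it mixes the two adjacent rates $s^\ast$ and $s^\ast+1$. -/

import Mathlib

open Filter Topology

/-- An adaptive transmitter over an `L`-state i.i.d. block fading channel, with buffer size `Q`,
Markov arrivals in `{0, …, A}` and transmission rates in `{0, …, S}`.
The channel states `h₁, …, h_L` are indexed by `Fin L`. -/
structure FadingLink (Q A S L : ℕ) where
  /-- at least one packet can arrive in a slot, so that the mean arrival rate is not zero -/
  A_pos : 0 < A
  /-- the maximum transmission rate is at least the maximum arrival rate -/
  A_le_S : A ≤ S
  /-- the buffer can hold the largest batch (needed for a feasible rate at a full buffer) -/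
  A_le_Q : A ≤ Q
  /-- transition probabilities of the arrival chain: `γ a a' = Pr(a[n+1] = a' ∣ a[n] = a)` -/
  γ : Matrix (Fin (A + 1)) (Fin (A + 1)) ℝ
  γ_nonneg : ∀ a a', 0 ≤ γ a a'
  γ_sum : ∀ a, ∑ a', γ a a' = 1
  /-- ergodicity of the arrival chain (aperiodicity is not required) -/
  γ_irreducible : γ.IsIrreducible
  /-- steady-state probabilities of the arrival chain -/
  φ : Fin (A + 1) → ℝ
  φ_nonneg : ∀ a, 0 ≤ φ a
  φ_sum : ∑ a, φ a = 1
  φ_stationary : ∀ a', ∑ a, φ a * γ a a' = φ a'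
  /-- channel coefficients -/
  h : Fin L → ℂ
  h_pos : ∀ ι, 0 < ‖h ι‖
  h_strictMono : StrictMono fun ι => ‖h ι‖
  /-- channel state probabilities: `η ι = Pr(h[n] = h_ι)` -/
  η : Fin L → ℝ
  η_nonneg : ∀ ι, 0 ≤ η ι
  η_sum : ∑ ι, η ι = 1
  /-- `P c s`: power needed to transmit `s` packets when the channel coefficient is `c` -/
  P : ℂ → ℕ → ℝ
  P_zero : ∀ ι, P (h ι) 0 = 0
  /-- the power is increasing in the rate on `{0, …, S}` -/
  P_mono : ∀ ι s, s + 1 ≤ S → P (h ι) s ≤ P (h ι) (s + 1)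
  /-- the power is convex in the rate on `{0, …, S}` -/
  P_convex : ∀ ι s, s + 2 ≤ S → 2 * P (h ι) (s + 1) ≤ P (h ι) s + P (h ι) (s + 2)

namespace FadingLink

variable {Q A S L : ℕ}

/-- System states `(q, a, ι)`: queue length, number of arrivals, index of the channel state. -/
abbrev State (_ : FadingLink Q A S L) : Type := Fin (Q + 1) × Fin (A + 1) × Fin L

/-- `s ∈ 𝒮(q)`, that is, `max {q - Q + A, 0} ≤ s ≤ min {q, S}`. -/
def Feasible (_ : FadingLink Q A S L) (q s : ℕ) : Prop := q + A ≤ Q + s ∧ s ≤ q ∧ s ≤ S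

/-- Mean number of arrivals in a slot. -/
noncomputable def α (M : FadingLink Q A S L) : ℝ := ∑ a : Fin (A + 1), (a : ℝ) * M.φ a

/-- A (stationary, randomized) transmission policy: `f (q, a, ι) s` is the probability of
transmitting `s` packets in state `(q, a, ι)`. -/
structure Policy (M : FadingLink Q A S L) where
  f : M.State → ℕ → ℝ
  nonneg : ∀ x s, 0 ≤ f x s
  sum_eq_one : ∀ x, ∑ s ∈ Finset.range (S + 1), f x s = 1
  eq_zero : ∀ x s, ¬ M.Feasible x.1 s → f x s = 0

/-- Probability of moving from state `x` to state `y` when `s` packets are transmitted; the queue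
evolves as `q' = min {max {q - s, 0} + a', Q}` (natural-number subtraction is truncated at `0`). -/
noncomputable def trans (M : FadingLink Q A S L) (x : M.State) (s : ℕ) (y : M.State) : ℝ :=
  M.γ x.2.1 y.2.1 * M.η y.2.2 *
    (if (y.1 : ℕ) = min ((x.1 : ℕ) - s + (y.2.1 : ℕ)) Q then 1 else 0)

/-- Law of the system state `(q[n], a[n], h[n])` under policy `F`, started in `x₀` at time `0`. -/
noncomputable def law (M : FadingLink Q A S L) (F : M.Policy) (x₀ : M.State) :
    ℕ → M.State → ℝ
  | 0 => fun y => if y = x₀ then 1 else 0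
  | n + 1 => fun y =>
      ∑ x, M.law F x₀ n x * ∑ s ∈ Finset.range (S + 1), F.f x s * M.trans x s y

/-- Expected power consumption `E[P_{h[n]}(s[n])]` in slot `n`. -/
noncomputable def expPower (M : FadingLink Q A S L) (F : M.Policy) (x₀ : M.State) (n : ℕ) : ℝ :=
  ∑ x, M.law F x₀ n x * ∑ s ∈ Finset.range (S + 1), F.f x s * M.P (M.h x.2.2) s

/-- Expected queue length `E[q[n]]` in slot `n`. -/
noncomputable def expQueue (M : FadingLink Q A S L) (F : M.Policy) (x₀ : M.State) (n : ℕ) : ℝ :=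
  ∑ x, M.law F x₀ n x * (x.1 : ℝ)

/-- `p` is the long-term average power `P_F` of policy `F` from the initial state `x₀`. -/
def HasAvgPower (M : FadingLink Q A S L) (F : M.Policy) (x₀ : M.State) (p : ℝ) : Prop :=
  Tendsto (fun N : ℕ => (1 / (N : ℝ)) * ∑ n ∈ Finset.Icc 1 N, M.expPower F x₀ n) atTop (𝓝 p)

/-- `d` is the average delay `D_F` of policy `F` from the initial state `x₀` (Little's law). -/
def HasAvgDelay (M : FadingLink Q A S L) (F : M.Policy) (x₀ : M.State) (d : ℝ) : Prop :=
  Tendsto (fun N : ℕ => (1 / (N : ℝ)) * ((1 / M.α) * ∑ n ∈ Finset.Icc 1 N, M.expQueue F x₀ n))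
    atTop (𝓝 d)

/-- `F` minimizes the average delay among all policies with average power at most `Pth`, for the
system started in `x₀`. -/
def IsOptimal (M : FadingLink Q A S L) (Pth : ℝ) (x₀ : M.State) (F : M.Policy) : Prop :=
  ∃ p d : ℝ, M.HasAvgPower F x₀ p ∧ M.HasAvgDelay F x₀ d ∧ p ≤ Pth ∧
    ∀ (G : M.Policy) (p' d' : ℝ), M.HasAvgPower G x₀ p' → M.HasAvgDelay G x₀ d' →
      p' ≤ Pth → d ≤ d'

/-- `τ s a ι`, for `-1 ≤ s ≤ S`, is an admissible family of thresholds: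
`τ (-1) a ι = -1` and `0 ≤ τ 0 a ι ≤ ⋯ ≤ τ S a ι ≤ Q`. -/
structure IsThresholds (_ : FadingLink Q A S L) (τ : ℤ → Fin (A + 1) → Fin L → ℤ) : Prop where
  neg_one : ∀ a ι, τ (-1) a ι = -1
  zero_le : ∀ a ι, 0 ≤ τ 0 a ι
  mono : ∀ (s : ℕ) a ι, s + 1 ≤ S → τ s a ι ≤ τ (s + 1) a ι
  le_Q : ∀ a ι, τ S a ι ≤ Q

/-- Policy `F` is threshold-based with thresholds `τ`: in state `(q, a, ι)` it uses the rate `s`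
with `τ (s - 1) a ι < q ≤ τ s a ι`, except that in the single state
`(τ sStar aStar ιStar, aStar, ιStar)`
it mixes the adjacent rates `sStar` and `sStar + 1`. -/
structure IsThresholdPolicy (M : FadingLink Q A S L) (F : M.Policy)
    (τ : ℤ → Fin (A + 1) → Fin L → ℤ) (sStar : ℕ) (aStar : Fin (A + 1)) (ιStar : Fin L) :
    Prop where
  regular : ∀ (q : Fin (Q + 1)) a ι (s : ℕ), s ≤ S → (a ≠ aStar ∨ s ≠ sStar ∨ ι ≠ ιStar) →
    τ (s - 1) a ι < (q : ℤ) → (q : ℤ) ≤ τ s a ι → F.f (q, a, ι) s = 1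
  star : ∀ q : Fin (Q + 1), τ (sStar - 1) aStar ιStar < (q : ℤ) →
    (q : ℤ) < τ sStar aStar ιStar → F.f (q, aStar, ιStar) sStar = 1
  mix : ∀ q : Fin (Q + 1), (q : ℤ) = τ sStar aStar ιStar →
    F.f (q, aStar, ιStar) sStar + F.f (q, aStar, ιStar) (sStar + 1) = 1
  otherwise : ∀ (q : Fin (Q + 1)) a ι (s : ℕ), s ≤ S →
    ¬ (τ (s - 1) a ι < (q : ℤ) ∧ (q : ℤ) ≤ τ s a ι) →
    ¬ (a = aStar ∧ ι = ιStar ∧ (q : ℤ) = τ sStar aStar ιStar ∧ (s = sStar ∨ s = sStar + 1)) →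
    F.f (q, a, ι) s = 0

end FadingLink

/-! Put a price `β ≥ 0` on power and minimize the average of queue length plus `β` times power. A
vanishing-discount limit solves the optimality equation with a relative value function `h` convex in
the queue length (`exists_bellman_solution`): for fixed arrivals and channel, the Bellman operator
is, up to a linear term, the infimal convolution of the convex power curve with a convex
continuation cost. Exchanging units between optimal splits of this convolution shows that the rates
attaining the minimum fill an interval `[lo, hi]` whose ends rise by 0 or 1 whenever the queue grows
by one (`Solves.exists_regular`). Monotone rules are threshold rules.

The Lagrangian cost of a stationary pair exceeds the optimal cost `g` by the average of its Bellman
defects (`lagrangian_sub`). Hence a policy using only tight rates is optimal for its price, and an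
optimal pair uses only tight rates where it has mass. Mixtures of two tight regular rules have only
constant harmonic functions (`unichain_mixPolicy`), so their averages do not depend on the initial
state.

Optimal power is nonincreasing in `β`. If every positive price admits an optimal pair within the
budget, `β → 0` gives a deterministic optimum. Otherwise, at the critical price, optimal pairs exist
with power on either side of `Pth`. A stochastic comparison of queues passes this to `lo` (power at
most `Pth`) and `hi` (at least `Pth`). Regular rules descend from `hi` to `lo` by lowering one state
at a time (`Regular.exists_lower`), so two rules differing in at most one state straddle `Pth`. A
convex combination of their stationary laws is stationary for a mixture of the rules
(`exists_mixPolicy_isStationary`) and can be given power exactly `Pth`; minimal Lagrangian cost then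
means minimal delay. -/

/-! ### Cesàro averages of linear iterations -/

section Cesaro

variable {X : Type*}

/-- The average of the terms `1, …, N` of a sequence. -/
noncomputable def cesaro (v : ℕ → X → ℝ) (N : ℕ) : X → ℝ :=
  (1 / (N : ℝ)) • ∑ n ∈ Finset.Icc 1 N, v n

lemma abs_cesaro_le {v : ℕ → X → ℝ} {C : ℝ} (hC : 0 ≤ C) (hv : ∀ n x, |v n x| ≤ C) (N : ℕ)
    (x : X) : |cesaro v N x| ≤ C := by
  rcases Nat.eq_zero_or_pos N with rfl | hN
  · simpa [cesaro] using hC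
  · have hN' : (0 : ℝ) < N := by exact_mod_cast hN
    simp only [cesaro, Pi.smul_apply, Finset.sum_apply, smul_eq_mul, abs_mul]
    rw [abs_of_pos (by positivity), div_mul_eq_mul_div, one_mul, div_le_iff₀ hN']
    calc |∑ n ∈ Finset.Icc 1 N, v n x| ≤ ∑ n ∈ Finset.Icc 1 N, |v n x| :=
          Finset.abs_sum_le_sum_abs _ _
      _ ≤ ∑ _n ∈ Finset.Icc 1 N, C := Finset.sum_le_sum fun n _ => hv n x
      _ = C * N := by simp [mul_comm]

/-- Applying `T` to an average shifts its terms, so `T` moves it only by `(v (n + 1) - v 1) / n`,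
which tends to 0. Compactness supplies the cluster point and continuity makes it fixed. It is used
for laws (`vecMul`) and for functions (`mulVec`). -/
lemma cesaro_cluster [Fintype X] (T : (X → ℝ) →ₗ[ℝ] (X → ℝ)) {v : ℕ → X → ℝ} {C : ℝ} (hC : 0 ≤ C)
    (hv : ∀ n x, |v n x| ≤ C) (hT : ∀ n, v (n + 1) = T (v n)) {N : ℕ → ℕ}
    (hN : Tendsto N atTop atTop) :
    ∃ (ψ : ℕ → ℕ) (w : X → ℝ), StrictMono ψ ∧ T w = w ∧
      Tendsto (fun k => cesaro v (N (ψ k))) atTop (𝓝 w) := by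
  have hmem : ∀ k, cesaro v (N k) ∈ Set.Icc (fun _ : X => -C) (fun _ => C) := fun k =>
    ⟨fun x => (abs_le.1 (abs_cesaro_le hC hv _ x)).1, fun x => (abs_le.1 (abs_cesaro_le hC hv _ x)).2⟩
  obtain ⟨w, -, ψ, hψ, hw⟩ := isCompact_Icc.tendsto_subseq hmem
  refine ⟨ψ, w, hψ, ?_, hw⟩
  have hTc : Continuous T := T.continuous_of_finiteDimensional
  have h1 : Tendsto (fun k => T (cesaro v (N (ψ k)))) atTop (𝓝 (T w)) :=
    (hTc.tendsto w).comp hw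
  have hNψ : Tendsto (fun k => N (ψ k)) atTop atTop := hN.comp hψ.tendsto_atTop
  have h2 : Tendsto (fun k => T (cesaro v (N (ψ k))) - cesaro v (N (ψ k))) atTop (𝓝 0) := by
    have key : ∀ n, T (cesaro v n) - cesaro v n = (1 / (n : ℝ)) • (v (n + 1) - v 1) := by
      intro n
      rw [cesaro, map_smul, map_sum, ← smul_sub, ← Finset.sum_sub_distrib]
      congr 1
      rw [Finset.sum_congr rfl fun i _ => by rw [← hT i], ← Finset.Ico_add_one_right_eq_Icc,
        Finset.sum_Ico_sub v (by omega)]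
    have h3 : Tendsto (fun n : ℕ => (1 / (n : ℝ)) • (v (n + 1) - v 1)) atTop (𝓝 0) := by
      rw [tendsto_pi_nhds]
      intro x
      have h4 : Tendsto (fun n : ℕ => (1 / (n : ℝ)) * (2 * C)) atTop (𝓝 0) := by
        simpa using (tendsto_one_div_atTop_nhds_zero_nat (𝕜 := ℝ)).mul_const (2 * C)
      refine squeeze_zero_norm (fun n => ?_) h4
      simp only [Pi.smul_apply, Pi.sub_apply, smul_eq_mul, Real.norm_eq_abs, abs_mul]
      rw [abs_of_nonneg (by positivity : (0 : ℝ) ≤ 1 / (n : ℝ))]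
      refine mul_le_mul_of_nonneg_left ?_ (by positivity)
      have := abs_sub (v (n + 1) x) (v 1 x)
      linarith [hv (n + 1) x, hv 1 x]
    simp_rw [key]
    exact h3.comp hNψ
  have h5 := h1.sub hw
  exact sub_eq_zero.1 (tendsto_nhds_unique h5 h2)

end Cesaro

namespace FadingLink

variable {Q A S L : ℕ} (M : FadingLink Q A S L)

open Matrix

/-! ### The Markov chain of a policy -/

/-- Irreducibility joins any two states by a path of positive transitions, and the property travels
along it. -/
lemma closed_induction {p : Fin (A + 1) → Prop} {a₀ : Fin (A + 1)} (h₀ : p a₀)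
    (h : ∀ a a', p a → 0 < M.γ a a' → p a') (a : Fin (A + 1)) : p a := by
  let : Quiver (Fin (A + 1)) := Matrix.toQuiver M.γ
  obtain ⟨w, -⟩ := M.γ_irreducible.connected a₀ a
  induction w with
  | nil => exact h₀
  | cons _ e ih => exact h _ _ ih e.down

/-- Otherwise the complement of `a'` would be closed under transitions; it is nonempty because `A ≥
1`. -/
lemma exists_pred (a' : Fin (A + 1)) : ∃ a, 0 < M.γ a a' := by
  by_contra! hne
  have hA := M.A_pos
  obtain ⟨b, hb⟩ : ∃ b : Fin (A + 1), b ≠ a' := by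
    have : Nontrivial (Fin (A + 1)) := Fin.nontrivial_iff_two_le.2 (by omega)
    exact exists_ne a'
  exact M.closed_induction (p := fun a => a ≠ a') hb
    (fun a c _ hac hc => (hne a).not_gt (hc ▸ hac)) a' rfl

/-- The state with queue length `min q Q`, arrivals `a` and channel state `ι`. -/
def st (q : ℕ) (a : Fin (A + 1)) (ι : Fin L) : M.State :=
  (⟨min q Q, by omega⟩, a, ι)

lemma st_self (x : M.State) : M.st x.1 x.2.1 x.2.2 = x := by
  obtain ⟨q, a, ι⟩ := x
  have : min (q : ℕ) Q = q := by omega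
  simp [st, this]

lemma st_fst {q : ℕ} (hq : q ≤ Q) (a ι) : ((M.st q a ι).1 : ℕ) = q := by
  simp [st, hq]

/-- Expected value of `u` at the next state, when `w` packets remain in the buffer and the current
number of arrivals is `a`. -/
noncomputable def next (u : M.State → ℝ) (w : ℕ) (a : Fin (A + 1)) : ℝ :=
  ∑ a', ∑ ι, M.γ a a' * M.η ι * u (M.st (w + a') a' ι)

lemma sum_weights (a : Fin (A + 1)) : ∑ a', ∑ ι, M.γ a a' * M.η ι = 1 := by
  simp_rw [← Finset.mul_sum, M.η_sum, mul_one, M.γ_sum]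

lemma weight_nonneg (a a' : Fin (A + 1)) (ι : Fin L) : 0 ≤ M.γ a a' * M.η ι :=
  mul_nonneg (M.γ_nonneg _ _) (M.η_nonneg _)

lemma next_mono {u v : M.State → ℝ} {w w' : ℕ} {a : Fin (A + 1)}
    (h : ∀ (a' : Fin (A + 1)) ι, u (M.st (w + a') a' ι) ≤ v (M.st (w' + a') a' ι)) :
    M.next u w a ≤ M.next v w' a :=
  Finset.sum_le_sum fun a' _ => Finset.sum_le_sum fun ι _ =>
    mul_le_mul_of_nonneg_left (h a' ι) (M.weight_nonneg a a' ι)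

lemma next_const (c : ℝ) (w : ℕ) (a : Fin (A + 1)) : M.next (fun _ => c) w a = c := by
  simp_rw [next, ← Finset.sum_mul, M.sum_weights, one_mul]

lemma next_sub (u v : M.State → ℝ) (w : ℕ) (a : Fin (A + 1)) :
    M.next (u - v) w a = M.next u w a - M.next v w a := by
  simp only [next, Pi.sub_apply, mul_sub, Finset.sum_sub_distrib]

lemma next_add_const (u : M.State → ℝ) (c : ℝ) (w : ℕ) (a : Fin (A + 1)) :
    M.next (fun x => u x + c) w a = M.next u w a + c := by
  simp only [next, mul_add, Finset.sum_add_distrib]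
  congr 1
  exact M.next_const c w a

lemma next_neg (u : M.State → ℝ) (w : ℕ) (a : Fin (A + 1)) :
    M.next (-u) w a = - M.next u w a := by
  simp only [next, Pi.neg_apply, mul_neg, Finset.sum_neg_distrib]

lemma sum_trans_mul (x : M.State) (s : ℕ) (u : M.State → ℝ) :
    ∑ y, M.trans x s y * u y = M.next u (x.1 - s) x.2.1 := by
  rw [Fintype.sum_prod_type_right, Fintype.sum_prod_type, next]
  refine Finset.sum_congr rfl fun a' _ => Finset.sum_congr rfl fun ι _ => ?_
  rw [Finset.sum_eq_single (M.st (x.1 - s + a') a' ι).1]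
  · simp [trans, st]
  · intro q _ hq
    have : (q : ℕ) ≠ min ((x.1 : ℕ) - s + a') Q := fun h => hq (Fin.ext h)
    simp [trans, this]
  · simp

variable {M}

/-- Transition matrix of the system state under a policy. -/
noncomputable def Policy.kernel (F : M.Policy) : Matrix M.State M.State ℝ :=
  fun x y => ∑ s ∈ Finset.range (S + 1), F.f x s * M.trans x s y

lemma Policy.kernel_mulVec (F : M.Policy) (u : M.State → ℝ) (x : M.State) :
    (F.kernel *ᵥ u) x =
      ∑ s ∈ Finset.range (S + 1), F.f x s * M.next u (x.1 - s) x.2.1 := by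
  simp only [mulVec, dotProduct, kernel, Finset.sum_mul]
  rw [Finset.sum_comm]
  refine Finset.sum_congr rfl fun s _ => ?_
  simp_rw [mul_assoc, ← Finset.mul_sum, sum_trans_mul]

lemma Policy.feasible (F : M.Policy) {x : M.State} {s : ℕ} (h : F.f x s ≠ 0) :
    M.Feasible x.1 s := by
  by_contra hs
  exact h (F.eq_zero x s hs)

lemma Policy.kernel_mulVec_one (F : M.Policy) : F.kernel *ᵥ 1 = 1 := by
  ext x
  rw [F.kernel_mulVec, Pi.one_apply, ← F.sum_eq_one x]
  refine Finset.sum_congr rfl fun s _ => ?_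
  rw [show (1 : M.State → ℝ) = fun _ => 1 from rfl, next_const, mul_one]

lemma trans_nonneg (x : M.State) (s : ℕ) (y : M.State) : 0 ≤ M.trans x s y :=
  mul_nonneg (M.weight_nonneg _ _ _) (by split_ifs <;> norm_num)

lemma Policy.kernel_nonneg (F : M.Policy) (x y : M.State) : 0 ≤ F.kernel x y :=
  Finset.sum_nonneg fun s _ => mul_nonneg (F.nonneg x s) (trans_nonneg x s y)

lemma Policy.abs_kernel_mulVec_le (F : M.Policy) {u : M.State → ℝ} {C : ℝ}
    (hu : ∀ x, |u x| ≤ C) (x : M.State) : |(F.kernel *ᵥ u) x| ≤ C := by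
  have h1 : ∑ y, F.kernel x y = 1 := by
    have := congrFun F.kernel_mulVec_one x
    simpa [mulVec, dotProduct] using this
  calc |(F.kernel *ᵥ u) x| ≤ ∑ y, |F.kernel x y * u y| := Finset.abs_sum_le_sum_abs _ _
    _ ≤ ∑ y, F.kernel x y * C := Finset.sum_le_sum fun y _ => by
        rw [abs_mul, abs_of_nonneg (F.kernel_nonneg x y)]
        exact mul_le_mul_of_nonneg_left (hu y) (F.kernel_nonneg x y)
    _ = C := by rw [← Finset.sum_mul, h1, one_mul]

/-- Probability vectors on the system states. -/
def IsProb (μ : M.State → ℝ) : Prop := (∀ x, 0 ≤ μ x) ∧ ∑ x, μ x = 1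

/-- Stationary distributions of the system state under a policy. -/
def IsStationary (F : M.Policy) (ρ : M.State → ℝ) : Prop :=
  IsProb ρ ∧ ρ ᵥ* F.kernel = ρ

lemma IsProb.abs_le_one {μ : M.State → ℝ} (h : IsProb μ) (x : M.State) : |μ x| ≤ 1 := by
  rw [abs_of_nonneg (h.1 x), ← h.2]
  exact Finset.single_le_sum (fun y _ => h.1 y) (Finset.mem_univ x)

lemma IsProb.vecMul {μ : M.State → ℝ} (h : IsProb μ) (F : M.Policy) :
    IsProb (μ ᵥ* F.kernel) := by
  refine ⟨fun y => Finset.sum_nonneg fun x _ => mul_nonneg (h.1 x) (F.kernel_nonneg x y), ?_⟩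
  have := dotProduct_mulVec μ F.kernel 1
  rw [F.kernel_mulVec_one] at this
  rw [← h.2]
  simpa [dotProduct] using this.symm

/-- Law of the state after `n` slots, from the initial distribution `μ`. -/
noncomputable def evolve (F : M.Policy) (μ : M.State → ℝ) : ℕ → M.State → ℝ
  | 0 => μ
  | n + 1 => evolve F μ n ᵥ* F.kernel

lemma evolve_isProb (F : M.Policy) {μ : M.State → ℝ} (h : IsProb μ) (n : ℕ) :
    IsProb (evolve F μ n) := by
  induction n with
  | zero => exact h
  | succ n ih => exact ih.vecMul F

lemma isProb_single (x₀ : M.State) : IsProb (fun y => if y = x₀ then (1 : ℝ) else 0) :=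
  ⟨fun y => by dsimp only; split_ifs <;> norm_num, by simp⟩

lemma law_eq_evolve (F : M.Policy) (x₀ : M.State) (n : ℕ) :
    M.law F x₀ n = evolve F (fun y => if y = x₀ then (1 : ℝ) else 0) n := by
  induction n with
  | zero => rfl
  | succ n ih => rw [law, evolve, ← ih]; rfl

lemma evolve_dotProduct (F : M.Policy) (μ u : M.State → ℝ) (n : ℕ) :
    evolve F μ n ⬝ᵥ u = μ ⬝ᵥ ((fun v => F.kernel *ᵥ v)^[n] u) := by
  induction n generalizing u with
  | zero => rfl
  | succ n ih => rw [evolve, ← dotProduct_mulVec, ih, Function.iterate_succ_apply]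

lemma exists_isStationary_tendsto (F : M.Policy) {μ : M.State → ℝ} (hμ : IsProb μ) :
    ∃ (ψ : ℕ → ℕ) (ρ : M.State → ℝ), StrictMono ψ ∧ IsStationary F ρ ∧
      Tendsto (fun k => cesaro (evolve F μ) (ψ k)) atTop (𝓝 ρ) := by
  obtain ⟨ψ, ρ, hψ, hρ, hlim⟩ := cesaro_cluster (vecMulLinear F.kernel) zero_le_one
    (fun n x => (evolve_isProb F hμ n).abs_le_one x) (fun n => rfl) tendsto_id
  refine ⟨ψ, ρ, hψ, ⟨⟨fun x => ?_, ?_⟩, hρ⟩, hlim⟩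
  · refine ge_of_tendsto' ((tendsto_pi_nhds.1 hlim) x) fun k => ?_
    simp only [cesaro, Pi.smul_apply, Finset.sum_apply, smul_eq_mul]
    exact mul_nonneg (by positivity) (Finset.sum_nonneg fun n _ => (evolve_isProb F hμ n).1 x)
  · have h1 : Tendsto (fun k => ∑ x, cesaro (evolve F μ) (ψ k) x) atTop (𝓝 (∑ x, ρ x)) :=
      tendsto_finsetSum _ fun x _ => (tendsto_pi_nhds.1 hlim) x
    refine tendsto_nhds_unique h1 (tendsto_const_nhds.congr' ?_)
    filter_upwards [eventually_gt_atTop 0] with k hk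
    have hk' : 0 < ψ k := hk.trans_le hψ.le_apply
    have hk'' : ((ψ k : ℕ) : ℝ) ≠ 0 := by positivity
    simp only [cesaro, Pi.smul_apply, Finset.sum_apply, smul_eq_mul]
    rw [← Finset.mul_sum, Finset.sum_comm, Finset.sum_congr rfl
      fun n _ => (evolve_isProb F hμ n).2]
    simp [hk'']

/-- The queue length as a function of the state. -/
def queue (x : M.State) : ℝ := (x.1 : ℝ)

/-- Expected power spent in a state. -/
noncomputable def Policy.power (F : M.Policy) (x : M.State) : ℝ :=
  ∑ s ∈ Finset.range (S + 1), F.f x s * M.P (M.h x.2.2) s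

lemma cesaro_dotProduct (v : ℕ → M.State → ℝ) (u : M.State → ℝ) (N : ℕ) :
    cesaro v N ⬝ᵥ u = (1 / (N : ℝ)) * ∑ n ∈ Finset.Icc 1 N, v n ⬝ᵥ u := by
  rw [cesaro, smul_dotProduct, sum_dotProduct, smul_eq_mul]

/-- Any average that exists can be computed along the subsequence on which the averaged laws
converge. One `ρ` serves power and delay at once, which reduces arbitrary competitors to stationary
pairs. -/
lemma exists_isStationary_of_hasAvg (F : M.Policy) (x₀ : M.State) :
    ∃ ρ, IsStationary F ρ ∧ (∀ p, M.HasAvgPower F x₀ p → ρ ⬝ᵥ F.power = p) ∧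
      ∀ d, M.HasAvgDelay F x₀ d → (1 / M.α) * (ρ ⬝ᵥ queue) = d := by
  obtain ⟨ψ, ρ, hψ, hρ, hlim⟩ := exists_isStationary_tendsto F (isProb_single x₀)
  have hdot : ∀ u : M.State → ℝ, Tendsto (fun k => (1 / (ψ k : ℝ)) *
      ∑ n ∈ Finset.Icc 1 (ψ k), M.law F x₀ n ⬝ᵥ u) atTop (𝓝 (ρ ⬝ᵥ u)) := by
    intro u
    have : Tendsto (fun k => cesaro (evolve F fun y => if y = x₀ then (1 : ℝ) else 0) (ψ k) ⬝ᵥ u)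
        atTop (𝓝 (ρ ⬝ᵥ u)) := by
      simp only [dotProduct]
      exact tendsto_finsetSum _ fun x _ => ((tendsto_pi_nhds.1 hlim) x).mul_const _
    simpa only [cesaro_dotProduct, ← law_eq_evolve] using this
  refine ⟨ρ, hρ, fun p hp => ?_, fun d hd => ?_⟩
  · exact tendsto_nhds_unique (hdot F.power) (hp.comp hψ.tendsto_atTop)
  · refine tendsto_nhds_unique ((hdot queue).const_mul (1 / M.α)) ?_
    refine (hd.comp hψ.tendsto_atTop).congr fun k => ?_
    simp only [Function.comp, mul_left_comm (1 / M.α)]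
    rfl

lemma exists_isStationary (F : M.Policy) (x₀ : M.State) : ∃ ρ, IsStationary F ρ :=
  let ⟨ρ, h, _⟩ := exists_isStationary_of_hasAvg F x₀
  ⟨ρ, h⟩

end FadingLink

/-! ### Convex sequences on an initial segment -/

/-- Convexity of a sequence on `{0, …, n}`. -/
def ConvexTo (f : ℕ → ℝ) (n : ℕ) : Prop := ∀ i, i + 2 ≤ n → 2 * f (i + 1) ≤ f i + f (i + 2)

lemma ConvexTo.exchange {f : ℕ → ℝ} {n : ℕ} (hf : ConvexTo f n) {i k : ℕ} (hik : i ≤ k)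
    (hk : k + 1 ≤ n) : f (i + 1) + f k ≤ f i + f (k + 1) := by
  induction k, hik using Nat.le_induction with
  | base => linarith
  | succ k hik ih => linarith [ih (by omega), hf k (by omega)]

/-- The infimal convolution of convex sequences is convex. -/
lemma ConvexTo.infConv {f g v : ℕ → ℝ} {m n N : ℕ} (hf : ConvexTo f m) (hg : ConvexTo g n)
    (hle : ∀ s w, s ≤ m → w ≤ n → s + w ≤ N → v (s + w) ≤ f s + g w)
    (heq : ∀ q ≤ N, ∃ s w, s ≤ m ∧ w ≤ n ∧ s + w = q ∧ v q = f s + g w) : ConvexTo v N := by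
  intro q hq
  obtain ⟨s, w, hs, hw, hsw, h1⟩ := heq q (by omega)
  obtain ⟨t, z, ht, hz, htz, h2⟩ := heq (q + 2) hq
  rw [h1, h2]
  -- The splits of `q` and `q + 2` differ by two units in total: one unit in each part, or at least
  -- two in a single part. Each case rearranges them into two splits of `q + 1` of no larger total
  -- cost.
  obtain h | h | h : (t = s + 1 ∧ z = w + 1) ∨ s + 2 ≤ t ∨ w + 2 ≤ z := by omega
  · obtain ⟨rfl, rfl⟩ := h
    have h3 := hle (s + 1) w ht hw (by omega)
    have h4 := hle s (w + 1) hs hz (by omega)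
    rw [show s + 1 + w = q + 1 by omega] at h3
    rw [show s + (w + 1) = q + 1 by omega] at h4
    linarith
  · obtain ⟨k, rfl⟩ : ∃ k, t = k + 1 := ⟨t - 1, by omega⟩
    have h3 := hle (s + 1) w (by omega) hw (by omega)
    have h4 := hle k z (by omega) hz (by omega)
    rw [show s + 1 + w = q + 1 by omega] at h3
    rw [show k + z = q + 1 by omega] at h4
    linarith [hf.exchange (i := s) (k := k) (by omega) ht]
  · obtain ⟨k, rfl⟩ : ∃ k, z = k + 1 := ⟨z - 1, by omega⟩
    have h3 := hle s (w + 1) hs (by omega) (by omega)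
    have h4 := hle t k ht (by omega) (by omega)
    rw [show s + (w + 1) = q + 1 by omega] at h3
    rw [show t + k = q + 1 by omega] at h4
    linarith [hg.exchange (i := w) (k := k) (by omega) hz]

/-- A family of functions, each bounding its gap to the maximum along the edges of a strongly
connected graph, has uniformly bounded oscillation. -/
lemma exists_uniform_span {Z I : Type*} [Finite Z] [Nonempty Z] (H : I → Z → ℝ)
    (E : Z → Z → Prop) (C : ℝ)
    (hE : ∀ z z', E z z' → ∃ e : ℝ, 0 < e ∧ ∀ i m, (∀ y, H i y ≤ m) →
      e * (m - H i z') ≤ C + (m - H i z))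
    (hconn : ∀ z z', Relation.ReflTransGen E z z') :
    ∃ K, ∀ i z z', H i z - H i z' ≤ K := by
  -- The two conditions on `m` force `z` to be a maximizer of `H i` with value `m`. Each edge turns
  -- a gap bound `K` into `(C + K) / e`, independently of `i`.
  have hR : ∀ z z', ∃ K, ∀ i m, (∀ y, H i y ≤ m) → m - H i z ≤ 0 → m - H i z' ≤ K := by
    intro z z'
    induction hconn z z' with
    | refl => exact ⟨0, fun i m _ h => h⟩
    | tail _ h ih =>
      obtain ⟨K, hK⟩ := ih
      obtain ⟨e, he, h⟩ := hE _ _ h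
      refine ⟨(C + K) / e, fun i m hm h0 => ?_⟩
      rw [le_div_iff₀ he, mul_comm]
      linarith [h i m hm, hK i m hm h0]
  choose K hK using hR
  obtain ⟨p, hp⟩ := Finite.exists_max fun p : Z × Z => K p.1 p.2
  refine ⟨K p.1 p.2, fun i z z' => ?_⟩
  obtain ⟨y, hy⟩ := Finite.exists_max (H i)
  linarith [hK y z' i (H i y) hy (by simp), hy z, hp (y, z')]

namespace FadingLink

variable {Q A S L : ℕ} (M : FadingLink Q A S L)

/-! ### The Bellman operator -/

/-- Cost of a slot with queue weight `1` and power weight `β`. -/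
def cost (β : ℝ) (x : M.State) (s : ℕ) : ℝ := (x.1 : ℝ) + β * M.P (M.h x.2.2) s

/-- The feasible rates in a queue state. -/
def rates (_ : FadingLink Q A S L) (q : ℕ) : Finset ℕ :=
  (Finset.range (S + 1)).filter fun s => q + A ≤ Q + s ∧ s ≤ q

variable {M}

lemma mem_rates {q s : ℕ} : s ∈ M.rates q ↔ M.Feasible q s := by
  simp only [rates, Finset.mem_filter, Finset.mem_range, Feasible]
  omega

lemma rates_nonempty (x : M.State) : (M.rates x.1).Nonempty := by
  -- The least feasible rate; truncated subtraction supplies the maximum with 0.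
  refine ⟨(x.1 + A) - Q, mem_rates.2 ?_⟩
  have := x.1.is_lt
  have := M.A_le_S
  have := M.A_le_Q
  refine ⟨?_, ?_, ?_⟩ <;> omega

instance instNonemptyState : Nonempty M.State := by
  have : Nonempty (Fin L) := by
    by_contra h
    rw [not_nonempty_iff] at h
    simpa using M.η_sum
  infer_instance

lemma P_nonneg (ι : Fin L) {s : ℕ} (hs : s ≤ S) : 0 ≤ M.P (M.h ι) s := by
  induction s with
  | zero => rw [M.P_zero]
  | succ s ih => exact (ih (by omega)).trans (M.P_mono ι s hs)

lemma cost_nonneg {β : ℝ} (hβ : 0 ≤ β) (x : M.State) {s : ℕ} (hs : s ≤ S) :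
    0 ≤ M.cost β x s :=
  add_nonneg (Nat.cast_nonneg _) (mul_nonneg hβ (P_nonneg _ hs))

lemma exists_cost_le (β : ℝ) : ∃ C, ∀ (x : M.State) (s : ℕ), s ≤ S → M.cost β x s ≤ C := by
  obtain ⟨p, hp⟩ := Finite.exists_max fun p : M.State × Fin (S + 1) => M.cost β p.1 p.2
  exact ⟨_, fun x s hs => hp (x, ⟨s, by omega⟩)⟩

/-- Optimal cost of a slot followed by a terminal cost `u` discounted by `δ`. -/
noncomputable def bellman (β δ : ℝ) (u : M.State → ℝ) (x : M.State) : ℝ :=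
  (M.rates x.1).inf' (rates_nonempty x) fun s => M.cost β x s + δ * M.next u (x.1 - s) x.2.1

lemma bellman_le (β δ : ℝ) (u : M.State → ℝ) {x : M.State} {s : ℕ} (hs : M.Feasible x.1 s) :
    bellman β δ u x ≤ M.cost β x s + δ * M.next u (x.1 - s) x.2.1 :=
  Finset.inf'_le _ (mem_rates.2 hs)

lemma exists_bellman_eq (β δ : ℝ) (u : M.State → ℝ) (x : M.State) :
    ∃ s, M.Feasible x.1 s ∧
      bellman β δ u x = M.cost β x s + δ * M.next u (x.1 - s) x.2.1 := by
  obtain ⟨s, hs, h⟩ := Finset.exists_mem_eq_inf' (rates_nonempty x) fun s =>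
    M.cost β x s + δ * M.next u (x.1 - s) x.2.1
  exact ⟨s, mem_rates.1 hs, h⟩

lemma bellman_sub_const (β δ : ℝ) (u : M.State → ℝ) (c : ℝ) (x : M.State) :
    bellman β δ (fun y => u y - c) x = bellman β δ u x - δ * c := by
  have hn : ∀ w a, M.next (fun y => u y - c) w a = M.next u w a - c := fun w a => by
    simpa [sub_eq_add_neg] using M.next_add_const u (-c) w a
  apply le_antisymm
  · obtain ⟨s, hs, h⟩ := exists_bellman_eq β δ u x
    have := bellman_le β δ (fun y => u y - c) hs
    rw [hn] at this
    rw [h]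
    linarith
  · obtain ⟨s, hs, h⟩ := exists_bellman_eq β δ (fun y => u y - c) x
    have := bellman_le β δ u hs
    rw [h, hn]
    linarith

lemma bellman_le_add {β δ : ℝ} (hδ : 0 ≤ δ) {u v : M.State → ℝ} {d : ℝ}
    (h : ∀ x, u x ≤ v x + d) (x : M.State) : bellman β δ u x ≤ bellman β δ v x + δ * d := by
  obtain ⟨s, hs, he⟩ := exists_bellman_eq β δ v x
  have h1 := bellman_le β δ u hs
  have h2 : M.next u (x.1 - s) x.2.1 ≤ M.next v (x.1 - s) x.2.1 + d := by
    rw [← next_add_const]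
    exact M.next_mono fun _ _ => h _
  have := mul_le_mul_of_nonneg_left h2 hδ
  rw [he]
  linarith

lemma bellman_contracting (β : ℝ) {δ : ℝ} (h0 : 0 ≤ δ) (h1 : δ < 1) :
    ContractingWith ⟨δ, h0⟩ (bellman (M := M) β δ) := by
  refine ⟨by exact_mod_cast h1, LipschitzWith.of_dist_le_mul fun u v => ?_⟩
  refine (dist_pi_le_iff (by positivity)).2 fun x => ?_
  have h : ∀ u v : M.State → ℝ, ∀ x, u x ≤ v x + dist u v := fun u v x => by
    have := (Real.dist_eq (u x) (v x)) ▸ dist_le_pi_dist u v x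
    linarith [le_abs_self (u x - v x)]
  change _ ≤ δ * _
  rw [Real.dist_eq, abs_le]
  have h2 := bellman_le_add (β := β) h0 (h u v) x
  have h3 := bellman_le_add (β := β) h0 (h v u) x
  rw [dist_comm v u] at h3
  constructor <;> linarith

/-- Convexity in the queue length. -/
def QConvex (u : M.State → ℝ) : Prop := ∀ a ι, ConvexTo (fun q => u (M.st q a ι)) Q

/-- With at most `Q - A` packets remaining, no arrival overflows the buffer, so the clipping in `st`
is inactive and convexity survives averaging. -/
lemma QConvex.next {u : M.State → ℝ} (hu : QConvex u) (a : Fin (A + 1)) :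
    ConvexTo (fun w => M.next u w a) (Q - A) := by
  intro w hw
  simp only [FadingLink.next, Finset.mul_sum, ← Finset.sum_add_distrib]
  refine Finset.sum_le_sum fun a' _ => Finset.sum_le_sum fun ι _ => ?_
  have h1 := a'.is_lt
  have h2 := hu a' ι (w + a') (by omega)
  have h3 := mul_le_mul_of_nonneg_left h2 (M.weight_nonneg a a' ι)
  rw [show w + 1 + (a' : ℕ) = w + a' + 1 by omega, show w + 2 + (a' : ℕ) = w + a' + 2 by omega]
  linarith

lemma power_convexTo {β : ℝ} (hβ : 0 ≤ β) (ι : Fin L) :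
    ConvexTo (fun s => β * M.P (M.h ι) s) S := fun s hs => by
  have := mul_le_mul_of_nonneg_left (M.P_convex ι s hs) hβ
  linarith

lemma ConvexTo_const_mul {f : ℕ → ℝ} {n : ℕ} (hf : ConvexTo f n) {c : ℝ} (hc : 0 ≤ c) :
    ConvexTo (fun i => c * f i) n := fun i hi => by
  have := mul_le_mul_of_nonneg_left (hf i hi) hc
  linarith

lemma QConvex.bellman {u : M.State → ℝ} (hu : QConvex u) {β δ : ℝ} (hβ : 0 ≤ β) (hδ : 0 ≤ δ) :
    QConvex (bellman β δ u) := by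
  intro a ι
  have hAQ := M.A_le_Q
  -- Splitting `q` into transmitted and remaining packets exhibits this function as an infimal
  -- convolution; feasibility is exactly `s ≤ S` together with `q - s ≤ Q - A`.
  have key : ConvexTo (fun q => FadingLink.bellman β δ u (M.st q a ι) - (q : ℝ)) Q := by
    refine (power_convexTo (M := M) hβ ι).infConv (ConvexTo_const_mul (hu.next a) hδ) ?_ ?_
    · intro s w hs hw hsw
      have hfst := M.st_fst hsw a ι
      have := bellman_le β δ u (x := M.st (s + w) a ι) (s := s) ⟨by omega, by omega, hs⟩
      simp only [cost, hfst, Nat.add_sub_cancel_left] at this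
      simp only [st] at this ⊢
      linarith
    · intro q hq
      obtain ⟨s, hs, h⟩ := exists_bellman_eq β δ u (M.st q a ι)
      rw [st_fst _ hq] at h hs
      obtain ⟨h1, h2, h3⟩ := hs
      refine ⟨s, q - s, h3, by omega, by omega, ?_⟩
      simp only [h, cost, st_fst _ hq]
      simp only [st]
      ring
  intro q hq
  have := key q hq
  push_cast at this
  linarith

/-- Value iteration started from 0 preserves convexity and nonnegativity, and both are closed under
pointwise limits. -/
lemma exists_discounted {β δ : ℝ} (hβ : 0 ≤ β) (h0 : 0 ≤ δ) (h1 : δ < 1) :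
    ∃ V : M.State → ℝ, (∀ x, bellman β δ V x = V x) ∧ QConvex V ∧ ∀ x, 0 ≤ V x := by
  have hc := bellman_contracting (M := M) β h0 h1
  have hlim := tendsto_pi_nhds.1 (hc.tendsto_iterate_fixedPoint 0)
  have hit : ∀ n, QConvex ((bellman (M := M) β δ)^[n] 0) ∧
      ∀ x, 0 ≤ (bellman (M := M) β δ)^[n] 0 x := by
    intro n
    induction n with
    | zero => exact ⟨fun a ι q _ => by simp, fun x => le_rfl⟩
    | succ n ih =>
      rw [Function.iterate_succ_apply']
      refine ⟨ih.1.bellman hβ h0, fun x => ?_⟩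
      obtain ⟨s, hs, h⟩ := exists_bellman_eq β δ ((bellman (M := M) β δ)^[n] 0) x
      rw [h]
      have h2 : 0 ≤ M.next ((bellman (M := M) β δ)^[n] 0) (x.1 - s) x.2.1 := by
        rw [← M.next_const 0 (x.1 - s) x.2.1]
        exact M.next_mono fun _ _ => ih.2 _
      exact add_nonneg (cost_nonneg hβ x hs.2.2) (mul_nonneg h0 h2)
  refine ⟨ContractingWith.fixedPoint _ hc, fun x => congrFun hc.fixedPoint_isFixedPt x, ?_,
    fun x => ge_of_tendsto' (hlim x) fun n => (hit n).2 x⟩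
  intro a ι q hq
  exact le_of_tendsto_of_tendsto' ((hlim _).const_mul 2) ((hlim _).add (hlim _))
    fun n => (hit n).1 a ι q hq

variable (M) in
/-- Possible moves of the pair (remaining packets, arrivals). -/
def Move (z z' : Fin (Q - A + 1) × Fin (A + 1)) : Prop :=
  0 < M.γ z.2 z'.2 ∧ (z'.1 : ℕ) ≤ z.1 + z'.2 ∧ (z.1 : ℕ) + z'.2 ≤ z'.1 + S

/-- Since `A ≤ S`, all new arrivals can be sent at once, so the arrival chain can wander while the
remainder stays fixed. The remainder rises by one on a transition into `A` arrivals and falls by one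
on a transition into 0 arrivals. -/
lemma move_connected (z z' : Fin (Q - A + 1) × Fin (A + 1)) :
    Relation.ReflTransGen M.Move z z' := by
  have hA := M.A_pos
  have hAS := M.A_le_S
  have hold : ∀ w a a', Relation.ReflTransGen M.Move (w, a) (w, a') := fun w a a' =>
    M.closed_induction (p := fun a' => Relation.ReflTransGen M.Move (w, a) (w, a')) .refl
      (fun b c hb hbc => hb.tail ⟨hbc, by dsimp only; omega, by dsimp only; omega⟩) a'
  have up : ∀ (n : ℕ) (h : n < Q - A + 1) a a',
      Relation.ReflTransGen M.Move (0, a) (⟨n, h⟩, a') := by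
    intro n
    induction n with
    | zero => exact fun _ a a' => hold _ a a'
    | succ n ih =>
      intro h a a'
      obtain ⟨b, hb⟩ := M.exists_pred (Fin.last A)
      refine ((ih (by omega) a b).tail ?_).trans (hold _ (Fin.last A) a')
      exact ⟨hb, by simp only [Fin.val_last]; omega, by simp only [Fin.val_last]; omega⟩
  have down : ∀ (n : ℕ) (h : n < Q - A + 1) a a',
      Relation.ReflTransGen M.Move (⟨n, h⟩, a) (0, a') := by
    intro n
    induction n with
    | zero => exact fun _ a a' => hold _ a a'
    | succ n ih =>
      intro h a a'
      obtain ⟨b, hb⟩ := M.exists_pred 0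
      refine (Relation.ReflTransGen.tail (hold _ a b) ?_).trans (ih (by omega) 0 a')
      exact ⟨hb, by simp, by simp only [Fin.val_zero]; omega⟩
  exact (down z.1 z.1.is_lt z.2 z.2).trans (up z'.1 z'.1.is_lt z.2 z'.2)

/-- Compare with a suboptimal action: leave `z'.1` packets if the arrivals are `z'.2`, and otherwise
send exactly the new arrivals. The resulting edge constant is a transition probability, hence
uniform in the discount factor. -/
lemma next_gap {β δ C m : ℝ} (h1 : δ ≤ 1)
    (hC : ∀ (x : M.State) (s : ℕ), s ≤ S → M.cost β x s ≤ C) {V : M.State → ℝ}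
    (hV : ∀ x, bellman β δ V x = V x) (hV0 : ∀ x, 0 ≤ V x)
    (hm : ∀ z : Fin (Q - A + 1) × Fin (A + 1), M.next V z.1 z.2 ≤ m)
    {z z' : Fin (Q - A + 1) × Fin (A + 1)} (hz : M.Move z z') :
    M.γ z.2 z'.2 * (m - M.next V z'.1 z'.2) ≤ C + (m - M.next V z.1 z.2) := by
  have hAQ := M.A_le_Q
  have hAS := M.A_le_S
  have hn0 : ∀ w a, 0 ≤ M.next V w a := fun w a => by
    rw [← M.next_const 0 w a]
    exact M.next_mono fun _ _ => hV0 _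
  have hle : ∀ (w : ℕ) (a : Fin (A + 1)) ι (w' : Fin (Q - A + 1)), w ≤ Q - A → w' ≤ w + (a : ℕ) →
      w + (a : ℕ) ≤ w' + S → V (M.st (w + a) a ι) ≤ C + M.next V w' a := by
    intro w a ι w' hw h2 h3
    have ha := a.is_lt
    have hw' := w'.is_lt
    have hfst : ((M.st (w + a) a ι).1 : ℕ) = w + a := M.st_fst (by omega) a ι
    have h4 := bellman_le β δ V (x := M.st (w + a) a ι) (s := w + a - w')
      ⟨by omega, by omega, by omega⟩
    rw [hV, hfst, show w + (a : ℕ) - (w + a - w') = w' by omega] at h4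
    have h5 : δ * M.next V w' a ≤ 1 * M.next V w' a := mul_le_mul_of_nonneg_right h1 (hn0 _ _)
    have h6 := hC (M.st (w + a) a ι) (w + a - w') (by omega)
    have h7 : (M.st (w + a) a ι).2.1 = a := rfl
    rw [h7] at h4
    linarith
  have hsum : M.next V z.1 z.2 ≤ ∑ a', M.γ z.2 a' *
      (C + m + if a' = z'.2 then M.next V z'.1 z'.2 - m else 0) := by
    refine Finset.sum_le_sum fun a' _ => ?_
    have : M.γ z.2 a' * (C + m + if a' = z'.2 then M.next V z'.1 z'.2 - m else 0) =
        ∑ ι, M.γ z.2 a' * M.η ι * (C + m + if a' = z'.2 then M.next V z'.1 z'.2 - m else 0) := by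
      rw [← Finset.sum_mul, ← Finset.mul_sum, M.η_sum, mul_one]
    rw [this]
    refine Finset.sum_le_sum fun ι _ => mul_le_mul_of_nonneg_left ?_ (M.weight_nonneg _ _ _)
    have hz1 := z.1.is_lt
    have ha' := a'.is_lt
    split_ifs with h
    · subst h
      have := hle z.1 z'.2 ι z'.1 (by omega) hz.2.1 hz.2.2
      linarith
    · have := hle z.1 a' ι z.1 (by omega) (by omega) (by omega)
      linarith [hm (z.1, a')]
  simp only [mul_add, Finset.sum_add_distrib, ← Finset.sum_mul, M.γ_sum, mul_ite, mul_zero,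
    Finset.sum_ite_eq', Finset.mem_univ, if_true] at hsum
  linarith

lemma exists_bellman_solution {β : ℝ} (hβ : 0 ≤ β) :
    ∃ (g : ℝ) (h : M.State → ℝ), QConvex h ∧ ∀ x, g + h x = bellman β 1 h x := by
  obtain ⟨C, hC⟩ := exists_cost_le (M := M) β
  -- Fixed points for all discount factors form one index set, so that the oscillation bound `K` is
  -- the same for all of them.
  let I := {p : ℝ × (M.State → ℝ) // (0 ≤ p.1 ∧ p.1 ≤ 1) ∧ (∀ x, bellman β p.1 p.2 x = p.2 x) ∧
    ∀ x, 0 ≤ p.2 x}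
  obtain ⟨K, hK⟩ := exists_uniform_span (I := I)
    (fun i (z : Fin (Q - A + 1) × Fin (A + 1)) => M.next i.1.2 z.1 z.2) M.Move C
    (fun z z' hz => ⟨_, hz.1, fun i m hm =>
      next_gap i.2.1.2 hC i.2.2.1 i.2.2.2 hm hz⟩) move_connected
  let δ : ℕ → ℝ := fun k => 1 - 1 / ((k : ℝ) + 1)
  have hδ0 : ∀ k, 0 ≤ δ k := fun k => by
    have : 1 / ((k : ℝ) + 1) ≤ 1 := by
      rw [div_le_one (by positivity)]
      linarith [(Nat.cast_nonneg k : (0 : ℝ) ≤ k)]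
    simp only [δ]; linarith
  have hδ1 : ∀ k, δ k < 1 := fun k => by
    have : 0 < 1 / ((k : ℝ) + 1) := by positivity
    simp only [δ]; linarith
  have hδlim : Tendsto δ atTop (𝓝 1) := by
    simpa [δ] using (tendsto_one_div_add_atTop_nhds_zero_nat (𝕜 := ℝ)).const_sub 1
  choose V hV hVc hV0 using fun k => exists_discounted (M := M) hβ (hδ0 k) (hδ1 k)
  let i : ℕ → I := fun k => ⟨(δ k, V k), ⟨hδ0 k, (hδ1 k).le⟩, hV k, hV0 k⟩
  have hK0 : 0 ≤ K := by
    have := hK (i 0) (0, 0) (0, 0)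
    simpa using this
  have hspan : ∀ k x y, V k x - V k y ≤ C + K := by
    intro k x y
    obtain ⟨s, hs⟩ := rates_nonempty x
    rw [mem_rates] at hs
    obtain ⟨t, ht, hy⟩ := exists_bellman_eq β (δ k) (V k) y
    have h1 := bellman_le β (δ k) (V k) hs
    rw [hV] at h1 hy
    have h2 := hC x s hs.2.2
    have h3 := cost_nonneg hβ y ht.2.2
    have h4 := hK (i k) (⟨x.1 - s, by have := hs.1; omega⟩, x.2.1)
      (⟨y.1 - t, by have := ht.1; omega⟩, y.2.1)
    have h5 := mul_le_mul_of_nonneg_left h4 (hδ0 k)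
    have h6 := mul_le_mul_of_nonneg_right (hδ1 k).le hK0
    simp only [i] at h5
    linarith
  obtain ⟨x₀⟩ := instNonemptyState (M := M)
  -- Normalization at `x₀` keeps the relative values bounded, although the discounted values may
  -- diverge as `δ k → 1`.
  let h : ℕ → M.State → ℝ := fun k x => V k x - V k x₀
  let g : ℕ → ℝ := fun k => (1 - δ k) * V k x₀
  have hgh : ∀ k x, g k + h k x = bellman β (δ k) (h k) x := by
    intro k x
    rw [bellman_sub_const, hV]
    simp only [g, h]
    ring
  have hC0 : 0 ≤ C := by
    have := hC x₀ 0 (Nat.zero_le _)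
    exact (cost_nonneg hβ x₀ (Nat.zero_le _)).trans this
  have hhb : ∀ k, h k ∈ Set.Icc (fun _ => -(C + K)) (fun _ => C + K) := fun k =>
    ⟨fun x => by have := hspan k x₀ x; simp only [h]; linarith, fun x => hspan k x x₀⟩
  have hgb : ∀ k, g k ∈ Set.Icc 0 (C + (C + K)) := by
    intro k
    refine ⟨mul_nonneg (by linarith [hδ1 k]) (hV0 k x₀), ?_⟩
    obtain ⟨s, hs⟩ := rates_nonempty x₀
    rw [mem_rates] at hs
    have h1 := bellman_le β (δ k) (h k) hs
    rw [← hgh] at h1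
    have h2 : M.next (h k) (x₀.1 - s) x₀.2.1 ≤ C + K := by
      rw [← M.next_const (C + K) (x₀.1 - s) x₀.2.1]
      exact M.next_mono fun _ _ => (hhb k).2 _
    have h3 := mul_le_mul_of_nonneg_left h2 (hδ0 k)
    have h4 := mul_le_mul_of_nonneg_right (hδ1 k).le (add_nonneg hC0 hK0)
    have h5 := hC x₀ s hs.2.2
    have h6 : h k x₀ = 0 := sub_self _
    linarith
  obtain ⟨⟨g', h'⟩, -, ψ, hψ, hlim⟩ := (isCompact_Icc.prod isCompact_Icc).tendsto_subseq
    (x := fun k => (g k, h k)) fun k => ⟨hgb k, hhb k⟩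
  rw [nhds_prod_eq] at hlim
  have hg' : Tendsto (fun k => g (ψ k)) atTop (𝓝 g') := hlim.fst
  have hh' : ∀ x, Tendsto (fun k => h (ψ k) x) atTop (𝓝 (h' x)) :=
    tendsto_pi_nhds.1 hlim.snd
  refine ⟨g', h', fun a ι q hq => ?_, fun x => ?_⟩
  · refine le_of_tendsto_of_tendsto' ((hh' _).const_mul 2) ((hh' _).add (hh' _)) fun k => ?_
    have := hVc (ψ k) a ι q hq
    simp only [h]
    linarith
  · refine tendsto_nhds_unique (hg'.add (hh' x)) ?_
    simp_rw [hgh]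
    refine Tendsto.finset_inf'_nhds_apply (rates_nonempty x) fun s _ => ?_
    refine tendsto_const_nhds.add ((hδlim.comp hψ.tendsto_atTop).mul ?_)
    exact tendsto_finsetSum _ fun a' _ => tendsto_finsetSum _ fun ι _ => (hh' _).const_mul _

end FadingLink

/-! ### Optimal splits in an infimal convolution -/

/-- `s + w` is split optimally, `v` being the infimal convolution of `f` and `g`. -/
structure OptSplit (f g v : ℕ → ℝ) (m n s w : ℕ) : Prop where
  left_le : s ≤ m
  right_le : w ≤ n
  eq : v (s + w) = f s + g w

section OptSplit

variable {f g v : ℕ → ℝ} {m n N s w t z : ℕ}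

/-- Neither new split can beat the infimal convolution; if together they cost no more than two
optimal splits, both are optimal. -/
lemma OptSplit.of_add_le (hle : ∀ s w, s ≤ m → w ≤ n → s + w ≤ N → v (s + w) ≤ f s + g w)
    {s' w' t' z' : ℕ} (h : OptSplit f g v m n s w) (h' : OptSplit f g v m n t z)
    (hs : s' ≤ m) (hw : w' ≤ n) (ht : t' ≤ m) (hz : z' ≤ n) (h1 : s' + w' = s + w)
    (h2 : t' + z' = t + z) (hN : s + w ≤ N) (hN' : t + z ≤ N)
    (hadd : f s' + g w' + (f t' + g z') ≤ f s + g w + (f t + g z)) :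
    OptSplit f g v m n s' w' ∧ OptSplit f g v m n t' z' := by
  have h3 := hle s' w' hs hw (by omega)
  have h4 := hle t' z' ht hz (by omega)
  have h5 := h.eq
  have h6 := h'.eq
  rw [← h1] at h5
  rw [← h2] at h6
  exact ⟨⟨hs, hw, by linarith⟩, ⟨ht, hz, by linarith⟩⟩

/-- Move one unit between two optimal splits of the same total, bringing them closer. Convexity
forbids an increase in cost, so the optimal left parts form an interval. -/
lemma OptSplit.succ_left (hf : ConvexTo f m) (hg : ConvexTo g n)
    (hle : ∀ s w, s ≤ m → w ≤ n → s + w ≤ N → v (s + w) ≤ f s + g w)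
    (h : OptSplit f g v m n s (w + 1)) (h' : OptSplit f g v m n t z)
    (hst : s < t) (heq : s + (w + 1) = t + z) (hN : t + z ≤ N) :
    OptSplit f g v m n (s + 1) w := by
  obtain ⟨k, rfl⟩ : ∃ k, t = k + 1 := ⟨t - 1, by omega⟩
  have h1 := hf.exchange (i := s) (k := k) (by omega) h'.left_le
  have h2 := hg.exchange (i := z) (k := w) (by omega) h.right_le
  have := h.left_le
  have := h'.left_le
  have := h.right_le
  have := h'.right_le
  exact (h.of_add_le hle h' (s' := s + 1) (w' := w) (t' := k) (z' := z + 1) (by omega) (by omega)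
    (by omega) (by omega) (by omega) (by omega) (by omega) hN (by linarith)).1

/-- Here the larger total has the smaller left part. Trading left parts evens out the right parts,
so convexity of `g` keeps both splits optimal; this yields monotonicity of the extreme rates. -/
lemma OptSplit.swap_right (hg : ConvexTo g n)
    (hle : ∀ s w, s ≤ m → w ≤ n → s + w ≤ N → v (s + w) ≤ f s + g w)
    (h : OptSplit f g v m n s w) (h' : OptSplit f g v m n t (z + 1))
    (hts : t < s) (heq : t + (z + 1) = s + w + 1) (hN : s + w + 1 ≤ N) :
    OptSplit f g v m n t z ∧ OptSplit f g v m n s (w + 1) := by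
  have h2 := hg.exchange (i := w) (k := z) (by omega) h'.right_le
  have := h.left_le
  have := h'.left_le
  have := h.right_le
  have := h'.right_le
  exact h.of_add_le hle h' (by omega) (by omega) (by omega) (by omega) (by omega) (by omega)
    (by omega) (by omega) (by linarith)

/-- Here the left part jumps by more than one as the total grows by one. Trading right parts evens
out the left parts, so convexity of `f` applies; this yields the bound by one on increments of the
rates. -/
lemma OptSplit.swap_left (hf : ConvexTo f m)
    (hle : ∀ s w, s ≤ m → w ≤ n → s + w ≤ N → v (s + w) ≤ f s + g w)
    (h : OptSplit f g v m n s w) (h' : OptSplit f g v m n (t + 1) z)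
    (hts : s < t) (heq : t + 1 + z = s + w + 1) (hN : s + w + 1 ≤ N) :
    OptSplit f g v m n t z ∧ OptSplit f g v m n (s + 1) w := by
  have h2 := hf.exchange (i := s) (k := t) (by omega) h'.left_le
  have := h.left_le
  have := h'.left_le
  have := h.right_le
  have := h'.right_le
  exact h.of_add_le hle h' (by omega) (by omega) (by omega) (by omega) (by omega) (by omega)
    (by omega) (by omega) (by linarith)

end OptSplit

namespace FadingLink

variable {Q A S L : ℕ} {M : FadingLink Q A S L}

/-! ### Regular selections of rates -/

/-- Feasible deterministic rules under which both the rate and the number of remaining packets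
are nondecreasing in the queue length. -/
structure Regular (σ : M.State → ℕ) : Prop where
  feasible : ∀ x, M.Feasible x.1 (σ x)
  mono : ∀ q a ι, q + 1 ≤ Q → σ (M.st q a ι) ≤ σ (M.st (q + 1) a ι)
  lip : ∀ q a ι, q + 1 ≤ Q → σ (M.st (q + 1) a ι) ≤ σ (M.st q a ι) + 1

lemma st_injective {q q' : ℕ} (hq : q ≤ Q) (hq' : q' ≤ Q) {a ι a' ι'}
    (h : M.st q a ι = M.st q' a' ι') : q = q' ∧ a = a' ∧ ι = ι' := by
  have h1 := M.st_fst hq a ι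
  rw [h, M.st_fst hq'] at h1
  exact ⟨h1.symm, congrArg (fun x => x.2.1) h, congrArg (fun x => x.2.2) h⟩

lemma Regular.mono_le {σ : M.State → ℕ} (hσ : Regular σ) {q q' : ℕ} (h : q ≤ q') (hq' : q' ≤ Q)
    (a ι) : σ (M.st q a ι) ≤ σ (M.st q' a ι) := by
  induction q', h using Nat.le_induction with
  | base => exact le_rfl
  | succ q' h ih => exact (ih (by omega)).trans (hσ.mono q' a ι hq')

/-- A regular rule that exceeds another one can be lowered by one in some state. -/
lemma Regular.exists_lower {lo σ : M.State → ℕ} (hlo : Regular lo) (hσ : Regular σ)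
    (hle : ∀ x, lo x ≤ σ x) (hne : lo ≠ σ) :
    ∃ x, lo x < σ x ∧ Regular (Function.update σ x (σ x - 1)) := by
  obtain ⟨y, hy⟩ : ∃ y, lo y < σ y := by
    by_contra! h
    exact hne (funext fun x => le_antisymm (hle x) (h x))
  -- Lowering `σ` at `x` fails only if the previous queue length has the same rate or the next one a
  -- rate larger by one. In either case regularity of `lo` keeps that neighbour above `lo`, and its
  -- weight `2σ - q` is larger by one, contradicting maximality.
  obtain ⟨x, hx, hmax⟩ := Set.exists_max_image {x | lo x < σ x}
    (fun x => 2 * (σ x : ℤ) - (x.1 : ℕ)) (Set.toFinite _) ⟨y, hy⟩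
  simp only [Set.mem_ofPred_eq] at hx hmax
  refine ⟨x, hx, fun y => ?_, fun q a ι hq => ?_, fun q a ι hq => ?_⟩
  · rcases eq_or_ne y x with rfl | hyx
    · obtain ⟨h1, h2, h3⟩ := hlo.feasible y
      obtain ⟨h4, h5, h6⟩ := hσ.feasible y
      rw [Function.update_self]
      exact ⟨by omega, by omega, by omega⟩
    · rw [Function.update_of_ne hyx]
      exact hσ.feasible y
  all_goals
    have h1 := hσ.mono q a ι hq
    have h2 := hσ.lip q a ι hq
    have h3 := hlo.mono q a ι hq
    have h4 := hlo.lip q a ι hq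
    have h5 := hmax (M.st q a ι)
    have h6 := hmax (M.st (q + 1) a ι)
    have h7 : M.st q a ι ≠ M.st (q + 1) a ι := fun h => by
      have := (st_injective (by omega) hq h).1
      omega
    rw [M.st_fst (by omega)] at h5
    rw [M.st_fst hq] at h6
    rcases eq_or_ne (M.st q a ι) x with h8 | h8
    · subst h8
      rw [M.st_fst (by omega)] at h5 h6
      rw [Function.update_self, Function.update_of_ne h7.symm]
      push_cast at h6
      omega
    · rw [Function.update_of_ne h8]
      rcases eq_or_ne (M.st (q + 1) a ι) x with h9 | h9
      · subst h9
        rw [M.st_fst hq] at h5 h6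
        rw [Function.update_self]
        push_cast at h5
        omega
      · rw [Function.update_of_ne h9]
        omega

/-- Convex solutions of the average cost optimality equation. -/
def Solves (β g : ℝ) (h : M.State → ℝ) : Prop :=
  QConvex h ∧ ∀ x, g + h x = bellman β 1 h x

/-- The rates attaining the minimum in the optimality equation. -/
def Tight (β g : ℝ) (h : M.State → ℝ) (x : M.State) (s : ℕ) : Prop :=
  M.Feasible x.1 s ∧ g + h x = M.cost β x s + M.next h (x.1 - s) x.2.1

lemma Solves.le {β g : ℝ} {h : M.State → ℝ} (H : Solves β g h) {x : M.State} {s : ℕ}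
    (hs : M.Feasible x.1 s) : g + h x ≤ M.cost β x s + M.next h (x.1 - s) x.2.1 := by
  rw [H.2]
  simpa using bellman_le β 1 h hs

lemma Solves.exists_tight {β g : ℝ} {h : M.State → ℝ} (H : Solves β g h) (x : M.State) :
    ∃ s, Tight β g h x s := by
  obtain ⟨s, hs, he⟩ := exists_bellman_eq β 1 h x
  exact ⟨s, hs, by rw [H.2, he, one_mul]⟩

lemma tight_iff {β g : ℝ} {h : M.State → ℝ} {q : ℕ} (hq : q ≤ Q) (a : Fin (A + 1)) (ι : Fin L)
    (s : ℕ) : Tight β g h (M.st q a ι) s ↔ ∃ w, s + w = q ∧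
      OptSplit (fun s => β * M.P (M.h ι) s) (fun w => M.next h w a)
        (fun q => g + h (M.st q a ι) - (q : ℝ)) S (Q - A) s w := by
  have hAQ := M.A_le_Q
  have h1 : ∀ s, M.cost β (M.st q a ι) s = q + β * M.P (M.h ι) s := fun s => by
    rw [cost, M.st_fst hq]; rfl
  have h2 : (M.st q a ι).2.1 = a := rfl
  simp only [Tight, M.st_fst hq, h1, h2]
  constructor
  · rintro ⟨⟨h3, h4, h5⟩, h6⟩
    have h7 : s + (q - s) = q := by omega
    refine ⟨q - s, h7, h5, by omega, ?_⟩
    simp only [h7]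
    linarith
  · rintro ⟨w, h3, h4, h5, h6⟩
    simp only [h3] at h6
    refine ⟨⟨by omega, by omega, h4⟩, ?_⟩
    rw [show q - s = w by omega]
    linarith

/-- The tight rates are those between two regular rules. -/
lemma Solves.exists_regular {β g : ℝ} (hβ : 0 ≤ β) {h : M.State → ℝ} (H : Solves β g h) :
    ∃ lo hi : M.State → ℕ, Regular lo ∧ Regular hi ∧
      ∀ x s, Tight β g h x s ↔ lo x ≤ s ∧ s ≤ hi x := by
  classical
  have hAQ := M.A_le_Q
  let T : M.State → Finset ℕ := fun x => (Finset.range (S + 1)).filter (Tight β g h x)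
  have hT : ∀ x s, s ∈ T x ↔ Tight β g h x s := fun x s => by
    simp only [T, Finset.mem_filter, Finset.mem_range, and_iff_right_iff_imp]
    intro hs
    have := hs.1.2.2
    omega
  have hne : ∀ x, (T x).Nonempty := fun x =>
    let ⟨s, hs⟩ := H.exists_tight x
    ⟨s, (hT x s).2 hs⟩
  let lo : M.State → ℕ := fun x => (T x).min' (hne x)
  let hi : M.State → ℕ := fun x => (T x).max' (hne x)
  have hlo : ∀ x, Tight β g h x (lo x) := fun x => (hT _ _).1 (Finset.min'_mem _ _)
  have hhi : ∀ x, Tight β g h x (hi x) := fun x => (hT _ _).1 (Finset.max'_mem _ _)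
  have hlo_le : ∀ x s, Tight β g h x s → lo x ≤ s := fun x s hs =>
    Finset.min'_le _ _ ((hT _ _).2 hs)
  have hle_hi : ∀ x s, Tight β g h x s → s ≤ hi x := fun x s hs =>
    Finset.le_max' _ _ ((hT _ _).2 hs)
  have hp := fun ι => power_convexTo (M := M) hβ ι
  have hn := fun a => H.1.next a
  have hv : ∀ a ι (s w : ℕ), s ≤ S → w ≤ Q - A → s + w ≤ Q →
      g + h (M.st (s + w) a ι) - ((s + w : ℕ) : ℝ) ≤ β * M.P (M.h ι) s + M.next h w a := by
    intro a ι s w hs hw hsw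
    have := H.le (x := M.st (s + w) a ι) (s := s) (by
      rw [M.st_fst hsw]
      exact ⟨by omega, by omega, hs⟩)
    rw [cost, M.st_fst hsw, Nat.add_sub_cancel_left] at this
    have h2 : (M.st (s + w) a ι).2 = (a, ι) := rfl
    rw [h2] at this
    linarith
  have down : ∀ q a ι, q + 1 ≤ Q → ∀ s t, Tight β g h (M.st q a ι) s →
      Tight β g h (M.st (q + 1) a ι) t → t < s →
      Tight β g h (M.st q a ι) t ∧ Tight β g h (M.st (q + 1) a ι) s := by
    intro q a ι hq s t hs ht hts
    rw [tight_iff (by omega)] at hs ⊢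
    rw [tight_iff hq] at ht ⊢
    obtain ⟨w, hw, hs⟩ := hs
    obtain ⟨z, hz, ht⟩ := ht
    obtain ⟨k, rfl⟩ : ∃ k, z = k + 1 := ⟨z - 1, by omega⟩
    obtain ⟨h1, h2⟩ := hs.swap_right (hn a) (hv a ι) ht hts (by omega) (by omega)
    exact ⟨⟨k, by omega, h1⟩, ⟨w + 1, by omega, h2⟩⟩
  have up : ∀ q a ι, q + 1 ≤ Q → ∀ s t, Tight β g h (M.st q a ι) s →
      Tight β g h (M.st (q + 1) a ι) t → s + 1 < t →
      Tight β g h (M.st q a ι) (t - 1) ∧ Tight β g h (M.st (q + 1) a ι) (s + 1) := by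
    intro q a ι hq s t hs ht hts
    rw [tight_iff (by omega)] at hs ⊢
    rw [tight_iff hq] at ht ⊢
    obtain ⟨w, hw, hs⟩ := hs
    obtain ⟨z, hz, ht⟩ := ht
    obtain ⟨k, rfl⟩ : ∃ k, t = k + 1 := ⟨t - 1, by omega⟩
    obtain ⟨h1, h2⟩ := hs.swap_left (hp ι) (hv a ι) ht (by omega) (by omega) (by omega)
    exact ⟨⟨z, by omega, h1⟩, ⟨w, by omega, h2⟩⟩
  refine ⟨lo, hi, ⟨fun x => (hlo x).1, fun q a ι hq => ?_, fun q a ι hq => ?_⟩,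
    ⟨fun x => (hhi x).1, fun q a ι hq => ?_, fun q a ι hq => ?_⟩,
    fun x s => ⟨fun hs => ⟨hlo_le x s hs, hle_hi x s hs⟩, fun hs => ?_⟩⟩
  · by_contra! hc
    exact hc.not_ge (hlo_le _ _ (down q a ι hq _ _ (hlo _) (hlo _) hc).1)
  · by_contra! hc
    exact hc.not_ge (hlo_le _ _ (up q a ι hq _ _ (hlo _) (hlo _) hc).2)
  · by_contra! hc
    exact hc.not_ge (hle_hi _ _ (down q a ι hq _ _ (hhi _) (hhi _) hc).2)
  · by_contra! hc
    have := hle_hi _ _ (up q a ι hq _ _ (hhi _) (hhi _) hc).1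
    omega
  · obtain ⟨h1, h2⟩ := hs
    induction s, h1 using Nat.le_induction with
    | base => exact hlo x
    | succ s h1 ih =>
      have ih := ih (by omega)
      have hhx := hhi x
      have hx := x.1.is_lt
      rw [← M.st_self x, tight_iff (by omega)] at ih hhx ⊢
      obtain ⟨w, hw, ih⟩ := ih
      obtain ⟨z, hz, hhx⟩ := hhx
      rw [M.st_self] at hz hhx
      obtain ⟨k, rfl⟩ : ∃ k, w = k + 1 := ⟨w - 1, by omega⟩
      exact ⟨k, by omega, ih.succ_left (hp _) (hn _) (hv _ _) hhx (by omega) (by omega)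
        (by omega)⟩

end FadingLink

namespace FadingLink

variable {Q A S L : ℕ} {M : FadingLink Q A S L}

open Matrix

/-! ### Mixtures of two deterministic rules -/

/-- The policy that uses `σ₁` with probability `θ` and `σ₀` otherwise, independently in each
slot. -/
noncomputable def mixPolicy (σ₀ σ₁ : M.State → ℕ) (h₀ : ∀ x, M.Feasible x.1 (σ₀ x))
    (h₁ : ∀ x, M.Feasible x.1 (σ₁ x)) (θ : ℝ) (hθ : 0 ≤ θ ∧ θ ≤ 1) : M.Policy where
  f x s := (1 - θ) * (if s = σ₀ x then 1 else 0) + θ * (if s = σ₁ x then 1 else 0)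
  nonneg x s := add_nonneg (mul_nonneg (by linarith) (by split_ifs <;> norm_num))
    (mul_nonneg hθ.1 (by split_ifs <;> norm_num))
  sum_eq_one x := by
    have h2 := (h₀ x).2.2
    have h3 := (h₁ x).2.2
    rw [Finset.sum_add_distrib, ← Finset.mul_sum, ← Finset.mul_sum, Finset.sum_ite_eq',
      Finset.sum_ite_eq', if_pos (Finset.mem_range.2 (by omega)),
      if_pos (Finset.mem_range.2 (by omega))]
    ring
  eq_zero x s hs := by
    have h2 : s ≠ σ₀ x := fun h => hs (h ▸ h₀ x)
    have h3 : s ≠ σ₁ x := fun h => hs (h ▸ h₁ x)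
    rw [if_neg h2, if_neg h3]
    ring

section Mix

variable {σ₀ σ₁ : M.State → ℕ} {h₀ : ∀ x, M.Feasible x.1 (σ₀ x)}
  {h₁ : ∀ x, M.Feasible x.1 (σ₁ x)} {θ : ℝ} {hθ : 0 ≤ θ ∧ θ ≤ 1}

lemma sum_mixPolicy_mul (x : M.State) (c : ℕ → ℝ) :
    ∑ s ∈ Finset.range (S + 1), (mixPolicy σ₀ σ₁ h₀ h₁ θ hθ).f x s * c s =
      (1 - θ) * c (σ₀ x) + θ * c (σ₁ x) := by
  have h2 := (h₀ x).2.2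
  have h3 := (h₁ x).2.2
  simp only [mixPolicy, add_mul, Finset.sum_add_distrib, mul_assoc, ← Finset.mul_sum, ite_mul,
    one_mul, zero_mul, Finset.sum_ite_eq']
  rw [if_pos (Finset.mem_range.2 (by omega)), if_pos (Finset.mem_range.2 (by omega))]

lemma mixPolicy_kernel_mulVec (u : M.State → ℝ) (x : M.State) :
    ((mixPolicy σ₀ σ₁ h₀ h₁ θ hθ).kernel *ᵥ u) x =
      (1 - θ) * M.next u (x.1 - σ₀ x) x.2.1 + θ * M.next u (x.1 - σ₁ x) x.2.1 := by
  rw [Policy.kernel_mulVec, sum_mixPolicy_mul x fun s => M.next u (x.1 - s) x.2.1]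

lemma mixPolicy_power (x : M.State) : (mixPolicy σ₀ σ₁ h₀ h₁ θ hθ).power x =
    (1 - θ) * M.P (M.h x.2.2) (σ₀ x) + θ * M.P (M.h x.2.2) (σ₁ x) :=
  sum_mixPolicy_mul x fun s => M.P (M.h x.2.2) s

end Mix

/-- The policy of a feasible deterministic rule. -/
noncomputable def detPolicy (σ : M.State → ℕ) (h : ∀ x, M.Feasible x.1 (σ x)) : M.Policy :=
  mixPolicy σ σ h h 0 ⟨le_rfl, zero_le_one⟩

lemma detPolicy_kernel_mulVec {σ : M.State → ℕ} (h : ∀ x, M.Feasible x.1 (σ x))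
    (u : M.State → ℝ) (x : M.State) :
    ((detPolicy σ h).kernel *ᵥ u) x = M.next u (x.1 - σ x) x.2.1 := by
  rw [detPolicy, mixPolicy_kernel_mulVec]
  ring

lemma detPolicy_power {σ : M.State → ℕ} (h : ∀ x, M.Feasible x.1 (σ x)) (x : M.State) :
    (detPolicy σ h).power x = M.P (M.h x.2.2) (σ x) := by
  rw [detPolicy, mixPolicy_power]
  ring

/-! ### Policies all of whose harmonic functions are constant -/

/-- All harmonic functions of the chain are constant, so that long-run averages do not depend on
the initial state. -/
def Unichain (F : M.Policy) : Prop :=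
  ∀ u : M.State → ℝ, F.kernel *ᵥ u = u → ∃ c, ∀ x, u x = c

lemma P_mono_le (ι : Fin L) {s t : ℕ} (hst : s ≤ t) (ht : t ≤ S) :
    M.P (M.h ι) s ≤ M.P (M.h ι) t := by
  induction t, hst using Nat.le_induction with
  | base => exact le_rfl
  | succ t hst ih => exact (ih (by omega)).trans (M.P_mono ι t ht)

/-- A harmonic function is at most as steep in the queue length as a solution of the optimality
equation for which both rules are tight. -/
lemma next_sub_succ_le {β g : ℝ} (hβ : 0 ≤ β) {h : M.State → ℝ} {σ₀ σ₁ : M.State → ℕ}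
    (hσ₀ : Regular σ₀) (hσ₁ : Regular σ₁) (ht₀ : ∀ x, Tight β g h x (σ₀ x))
    (ht₁ : ∀ x, Tight β g h x (σ₁ x)) {θ : ℝ} (hθ : 0 ≤ θ ∧ θ ≤ 1) {u : M.State → ℝ}
    (hu : (mixPolicy σ₀ σ₁ hσ₀.feasible hσ₁.feasible θ hθ).kernel *ᵥ u = u) (w : ℕ)
    (hw : w + 1 ≤ Q - A) (a : Fin (A + 1)) :
    M.next u (w + 1) a - M.next u w a ≤ M.next h (w + 1) a - M.next h w a := by
  have hAQ := M.A_le_Q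
  let V : ℕ → Fin (A + 1) → ℝ := M.next (u - h)
  have hV : ∀ w a, V w a = M.next u w a - M.next h w a := M.next_sub u h
  -- The slopes of the continuation value of `u - h`. Regularity will bound every slope by `m - 1`,
  -- where `m` is the positive part of the largest one, so all slopes are negative.
  let Δ : Fin (Q - A) × Fin (A + 1) → ℝ := fun z => V (z.1 + 1) z.2 - V z.1 z.2
  obtain ⟨z₀, hz₀⟩ := @Finite.exists_max _ _ _ ⟨((⟨w, by omega⟩ : Fin (Q - A)), a)⟩ _ Δ
  set m := max (Δ z₀) 0 with hm
  have hm0 : 0 ≤ m := le_max_right _ _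
  have hΔm : ∀ (w : ℕ) (a : Fin (A + 1)), w + 1 ≤ Q - A → V (w + 1) a - V w a ≤ m :=
    fun w a hw => (hz₀ (⟨w, by omega⟩, a)).trans (le_max_left _ _)
  -- One more packet in the queue is either kept, changing `V` by at most `m`, or sent, which leaves
  -- `V` alone and does not decrease the power.
  have hrule : ∀ σ : M.State → ℕ, Regular σ → ∀ q a ι, q + 1 ≤ Q →
      (V (q + 1 - σ (M.st (q + 1) a ι)) a - β * M.P (M.h ι) (σ (M.st (q + 1) a ι))) -
        (V (q - σ (M.st q a ι)) a - β * M.P (M.h ι) (σ (M.st q a ι))) ≤ m := by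
    intro σ hσ q a ι hq
    have h1 := hσ.mono q a ι hq
    have h2 := hσ.lip q a ι hq
    obtain ⟨h3, h4, h5⟩ := hσ.feasible (M.st q a ι)
    obtain ⟨h6, h7, h8⟩ := hσ.feasible (M.st (q + 1) a ι)
    rw [M.st_fst (by omega)] at h3 h4
    rw [M.st_fst hq] at h6 h7
    obtain h | h : σ (M.st (q + 1) a ι) = σ (M.st q a ι) ∨
      σ (M.st (q + 1) a ι) = σ (M.st q a ι) + 1 := by omega
    · rw [h, show q + 1 - σ (M.st q a ι) = q - σ (M.st q a ι) + 1 by omega]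
      have := hΔm (q - σ (M.st q a ι)) a (by omega)
      linarith
    · rw [h] at h8 ⊢
      rw [show q + 1 - (σ (M.st q a ι) + 1) = q - σ (M.st q a ι) by omega]
      have := mul_le_mul_of_nonneg_left (P_mono_le (M := M) ι (Nat.le_succ _) h8) hβ
      simp only [Nat.succ_eq_add_one] at this
      linarith
  have hval : ∀ q a ι, q ≤ Q → (u - h) (M.st q a ι) =
      (1 - θ) * (V (q - σ₀ (M.st q a ι)) a - β * M.P (M.h ι) (σ₀ (M.st q a ι))) +
      θ * (V (q - σ₁ (M.st q a ι)) a - β * M.P (M.h ι) (σ₁ (M.st q a ι))) - q + g := by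
    intro q a ι hq
    have h1 := congrFun hu (M.st q a ι)
    have h2 := (ht₀ (M.st q a ι)).2
    have h3 := (ht₁ (M.st q a ι)).2
    have h4 : (M.st q a ι).2 = (a, ι) := rfl
    rw [mixPolicy_kernel_mulVec] at h1
    rw [cost] at h2 h3
    rw [M.st_fst hq, h4] at h1 h2 h3
    rw [Pi.sub_apply, hV, hV]
    linear_combination -h1 + (θ - 1) * h2 - θ * h3
  -- The gain of 1 is the queue-length term of the cost, which enters `u - h` with a minus sign.
  have hstep : ∀ z, Δ z ≤ m - 1 := by
    rintro ⟨w, a⟩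
    have hw := w.is_lt
    have : M.next (u - h) (w + 1) a ≤ M.next (fun x => (u - h) x + (m - 1)) w a := by
      simp only [next]
      refine Finset.sum_le_sum fun a' _ => Finset.sum_le_sum fun ι _ =>
        mul_le_mul_of_nonneg_left ?_ (M.weight_nonneg a a' ι)
      have ha' := a'.is_lt
      have hq : (w : ℕ) + a' + 1 ≤ Q := by omega
      have h0 := mul_le_mul_of_nonneg_left (hrule σ₀ hσ₀ (w + a') a' ι hq) (sub_nonneg.2 hθ.2)
      have h1 := mul_le_mul_of_nonneg_left (hrule σ₁ hσ₁ (w + a') a' ι hq) hθ.1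
      rw [show (w : ℕ) + 1 + a' = w + a' + 1 by omega, hval _ a' ι hq,
        hval (w + a') a' ι (by omega)]
      push_cast
      linarith
    rw [next_add_const] at this
    simp only [Δ, V]
    linarith
  have h1 := hstep z₀
  have h2 : Δ z₀ < 0 := by
    by_contra! h
    rw [hm, max_eq_left h] at h1
    linarith
  have h3 := hz₀ (⟨w, by omega⟩, a)
  simp only [Δ, hV] at h3 h2
  linarith

/-- Maximum principle: the set where `v` is maximal is closed under positive transitions. -/
lemma eq_const_of_harmonic {v : Fin (A + 1) → ℝ} (hv : ∀ a, ∑ a', M.γ a a' * v a' = v a)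
    (a b : Fin (A + 1)) : v a = v b := by
  obtain ⟨c, hc⟩ := Finite.exists_max v
  have key : ∀ a, v a = v c := M.closed_induction (a₀ := c) rfl fun a a' ha hpos => by
    have h1 : ∑ b, M.γ a b * (v c - v b) = 0 := by
      simp only [mul_sub, Finset.sum_sub_distrib, ← Finset.sum_mul, M.γ_sum, hv, ha]
      ring
    have h2 := (Finset.sum_eq_zero_iff_of_nonneg fun b _ =>
      mul_nonneg (M.γ_nonneg a b) (sub_nonneg.2 (hc b))).1 h1 a' (Finset.mem_univ _)
    have h3 := (mul_eq_zero.1 h2).resolve_left hpos.ne'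
    linarith
  rw [key a, key b]

/-- Multiples of harmonic functions are harmonic, so the slope bound of `next_sub_succ_le` for all
`n • u` makes the slopes of `u` nonpositive; `-u` makes them zero. What remains depends on the
arrivals alone and is harmonic for the irreducible arrival chain. -/
lemma unichain_mixPolicy {β g : ℝ} (hβ : 0 ≤ β) {h : M.State → ℝ} {σ₀ σ₁ : M.State → ℕ}
    (hσ₀ : Regular σ₀) (hσ₁ : Regular σ₁) (ht₀ : ∀ x, Tight β g h x (σ₀ x))
    (ht₁ : ∀ x, Tight β g h x (σ₁ x)) {θ : ℝ} (hθ : 0 ≤ θ ∧ θ ≤ 1) :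
    Unichain (mixPolicy σ₀ σ₁ hσ₀.feasible hσ₁.feasible θ hθ) := by
  have hAQ := M.A_le_Q
  have hle : ∀ u : M.State → ℝ,
      (mixPolicy σ₀ σ₁ hσ₀.feasible hσ₁.feasible θ hθ).kernel *ᵥ u = u → ∀ w a, w + 1 ≤ Q - A →
      M.next u (w + 1) a ≤ M.next u w a := by
    intro u hu w a hw
    by_contra! hc
    obtain ⟨n, hn⟩ := Archimedean.arch (M.next h (w + 1) a - M.next h w a + 1) (sub_pos.2 hc)
    have h1 := next_sub_succ_le hβ hσ₀ hσ₁ ht₀ ht₁ hθ (u := (n : ℝ) • u)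
      (by rw [mulVec_smul, hu]) w hw a
    have h2 : ∀ w a, M.next ((n : ℝ) • u) w a = n * M.next u w a := fun w a => by
      simp only [next, Pi.smul_apply, smul_eq_mul, Finset.mul_sum]
      refine Finset.sum_congr rfl fun _ _ => Finset.sum_congr rfl fun _ _ => by ring
    rw [h2, h2] at h1
    rw [nsmul_eq_mul] at hn
    linarith
  intro u hu
  have heq : ∀ w a, w + 1 ≤ Q - A → M.next u (w + 1) a = M.next u w a := by
    intro w a hw
    have h1 := hle u hu w a hw
    have h2 := hle (-u) (by rw [mulVec_neg, hu]) w a hw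
    rw [next_neg, next_neg] at h2
    linarith
  have heq0 : ∀ w a, w ≤ Q - A → M.next u w a = M.next u 0 a := by
    intro w a hw
    induction w with
    | zero => rfl
    | succ w ih => rw [heq w a hw, ih (by omega)]
  have hval : ∀ x : M.State, u x = M.next u 0 x.2.1 := by
    intro x
    have h1 := congrFun hu x
    have h2 := (hσ₀.feasible x).1
    have h3 := (hσ₁.feasible x).1
    rw [mixPolicy_kernel_mulVec, heq0 (x.1 - σ₀ x) _ (by omega),
      heq0 (x.1 - σ₁ x) _ (by omega)] at h1
    linarith
  refine ⟨M.next u 0 0, fun x => ?_⟩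
  rw [hval]
  refine eq_const_of_harmonic (M := M) (v := fun a => M.next u 0 a) (fun a => ?_) _ _
  conv_rhs => rw [next]
  refine Finset.sum_congr rfl fun a' _ => ?_
  calc M.γ a a' * M.next u 0 a' = ∑ ι, M.γ a a' * M.η ι * M.next u 0 a' := by
        rw [← Finset.sum_mul, ← Finset.mul_sum, M.η_sum, mul_one]
    _ = _ := Finset.sum_congr rfl fun ι _ => by rw [hval (M.st _ a' ι)]; rfl

/-! ### Long-run averages of unichain policies -/

lemma IsStationary.dotProduct_iterate {F : M.Policy} {ρ : M.State → ℝ} (hρ : IsStationary F ρ)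
    (u : M.State → ℝ) (n : ℕ) : ρ ⬝ᵥ (fun v => F.kernel *ᵥ v)^[n] u = ρ ⬝ᵥ u := by
  induction n generalizing u with
  | zero => rfl
  | succ n ih => rw [Function.iterate_succ_apply, ih, dotProduct_mulVec, hρ.2]

lemma IsStationary.dotProduct_cesaro {F : M.Policy} {ρ : M.State → ℝ} (hρ : IsStationary F ρ)
    (u : M.State → ℝ) {n : ℕ} (hn : 0 < n) :
    ρ ⬝ᵥ cesaro (fun k => (fun v => F.kernel *ᵥ v)^[k] u) n = ρ ⬝ᵥ u := by
  have hn' : (n : ℝ) ≠ 0 := by positivity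
  rw [dotProduct_comm, cesaro_dotProduct]
  simp_rw [dotProduct_comm _ ρ, hρ.dotProduct_iterate]
  simp [hn']

/-- Every cluster point is harmonic, hence constant, and pairing with `ρ` identifies the constant.
So every subsequence has a further subsequence with the same limit. -/
lemma Unichain.tendsto_cesaro {F : M.Policy} (hF : Unichain F) {ρ : M.State → ℝ}
    (hρ : IsStationary F ρ) (u : M.State → ℝ) :
    Tendsto (cesaro fun n => (fun v => F.kernel *ᵥ v)^[n] u) atTop (𝓝 fun _ => ρ ⬝ᵥ u) := by
  obtain ⟨y, hy⟩ := Finite.exists_max fun x => |u x|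
  have hb : ∀ n x, |(fun v => F.kernel *ᵥ v)^[n] u x| ≤ |u y| := by
    intro n
    induction n with
    | zero => exact hy
    | succ n ih =>
      rw [Function.iterate_succ_apply']
      exact F.abs_kernel_mulVec_le ih
  refine tendsto_of_subseq_tendsto fun N hN => ?_
  obtain ⟨ψ, w, hψ, hw, hlim⟩ := cesaro_cluster (mulVecLin F.kernel) (abs_nonneg _) hb
    (fun n => Function.iterate_succ_apply' _ _ _) hN
  obtain ⟨c, hc⟩ := hF w hw
  have hcu : ρ ⬝ᵥ u = c := by
    have h1 : Tendsto (fun k => ρ ⬝ᵥ cesaro (fun n => (fun v => F.kernel *ᵥ v)^[n] u) (N (ψ k)))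
        atTop (𝓝 (ρ ⬝ᵥ w)) :=
      tendsto_finsetSum _ fun x _ => ((tendsto_pi_nhds.1 hlim) x).const_mul _
    have h2 : ρ ⬝ᵥ w = c := by
      simp only [dotProduct, hc, ← Finset.sum_mul, hρ.1.2, one_mul]
    rw [h2] at h1
    refine tendsto_nhds_unique (tendsto_const_nhds.congr' ?_) h1
    filter_upwards [(hN.comp hψ.tendsto_atTop).eventually_gt_atTop 0] with k hk
    exact (hρ.dotProduct_cesaro u hk).symm
  refine ⟨ψ, ?_⟩
  rw [hcu, show (fun _ : M.State => c) = w from funext fun x => (hc x).symm]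
  exact hlim

lemma Unichain.tendsto_avg {F : M.Policy} (hF : Unichain F) {ρ : M.State → ℝ}
    (hρ : IsStationary F ρ) (u : M.State → ℝ) (x₀ : M.State) :
    Tendsto (fun N : ℕ => (1 / (N : ℝ)) * ∑ n ∈ Finset.Icc 1 N, M.law F x₀ n ⬝ᵥ u) atTop
      (𝓝 (ρ ⬝ᵥ u)) := by
  refine ((tendsto_pi_nhds.1 (hF.tendsto_cesaro hρ u)) x₀).congr fun N => ?_
  simp only [cesaro, Pi.smul_apply, Finset.sum_apply, smul_eq_mul]
  congr 1
  refine Finset.sum_congr rfl fun n _ => ?_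
  rw [law_eq_evolve, evolve_dotProduct]
  simp [dotProduct]

lemma α_nonneg : 0 ≤ M.α :=
  Finset.sum_nonneg fun a _ => mul_nonneg (Nat.cast_nonneg _) (M.φ_nonneg a)

/-- A unichain policy whose stationary distribution is optimal is optimal from every state. -/
lemma Unichain.isOptimal {F : M.Policy} (hF : Unichain F) {ρ : M.State → ℝ}
    (hρ : IsStationary F ρ) {Pth : ℝ} (hP : ρ ⬝ᵥ F.power ≤ Pth)
    (hopt : ∀ (G : M.Policy) (ρ' : M.State → ℝ), IsStationary G ρ' → ρ' ⬝ᵥ G.power ≤ Pth →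
      ρ ⬝ᵥ queue ≤ ρ' ⬝ᵥ queue) (x₀ : M.State) : M.IsOptimal Pth x₀ F := by
  refine ⟨ρ ⬝ᵥ F.power, 1 / M.α * (ρ ⬝ᵥ queue), hF.tendsto_avg hρ _ x₀, ?_, hP, ?_⟩
  · refine ((hF.tendsto_avg hρ queue x₀).const_mul (1 / M.α)).congr fun N => ?_
    simp only [mul_left_comm (1 / M.α)]
    rfl
  · intro G p' d' hp hd hle
    obtain ⟨ρ', hρ', h1, h2⟩ := exists_isStationary_of_hasAvg G x₀
    rw [← h2 d' hd]
    refine mul_le_mul_of_nonneg_left (hopt G ρ' hρ' ?_) (one_div_nonneg.2 α_nonneg)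
    rw [h1 p' hp]
    exact hle

/-! ### Comparison of queue lengths -/

lemma next_le_next_of_le {u : M.State → ℝ} (hu : ∀ a ι, Monotone fun q => u (M.st q a ι))
    {w w' : ℕ} (h : w ≤ w') (a : Fin (A + 1)) : M.next u w a ≤ M.next u w' a :=
  M.next_mono fun a' ι => hu a' ι (by omega)

lemma monotone_of_succ {u : M.State → ℝ}
    (hu : ∀ q a ι, q + 1 ≤ Q → u (M.st q a ι) ≤ u (M.st (q + 1) a ι)) (a ι) :
    Monotone fun q => u (M.st q a ι) := by
  refine monotone_nat_of_le_succ fun q => ?_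
  by_cases hq : q + 1 ≤ Q
  · exact hu q a ι hq
  · have : M.st (q + 1) a ι = M.st q a ι := by
      simp only [st, Prod.mk.injEq, Fin.mk.injEq, and_true]
      omega
    exact (congrArg u this).ge

/-- Because the rate grows by at most one per packet, a longer queue leaves at least as many packets
behind: the chain is stochastically monotone. -/
lemma Regular.mulVec_mono {σ : M.State → ℕ} (hσ : Regular σ) {u : M.State → ℝ}
    (hu : ∀ a ι, Monotone fun q => u (M.st q a ι)) (a ι) :
    Monotone fun q => ((detPolicy σ hσ.feasible).kernel *ᵥ u) (M.st q a ι) := by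
  refine monotone_of_succ (fun q a ι hq => ?_) a ι
  rw [detPolicy_kernel_mulVec, detPolicy_kernel_mulVec, M.st_fst hq, M.st_fst (by omega)]
  have := hσ.lip q a ι hq
  exact next_le_next_of_le hu (by omega) a

lemma IsStationary.dotProduct_eq_sum {G : M.Policy} {ρ : M.State → ℝ} (hρ : IsStationary G ρ)
    (u : M.State → ℝ) : ρ ⬝ᵥ u =
      ∑ x, ∑ s ∈ Finset.range (S + 1), ρ x * G.f x s * M.next u (x.1 - s) x.2.1 := by
  nth_rewrite 1 [← hρ.2]
  rw [← dotProduct_mulVec, dotProduct]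
  simp_rw [G.kernel_mulVec, Finset.mul_sum, mul_assoc]

lemma Policy.dotProduct_eq_sum (G : M.Policy) (ρ u : M.State → ℝ) :
    ρ ⬝ᵥ u = ∑ x, ∑ s ∈ Finset.range (S + 1), ρ x * G.f x s * u x := by
  simp_rw [← Finset.sum_mul, ← Finset.mul_sum, G.sum_eq_one, mul_one]
  rfl

/-- Run the rule from `ρ`. Monotone functions stay monotone under the kernel, so the one-step
comparison iterates and passes to the averaged laws. The sign `ε` treats longer and shorter queues
together. -/
lemma Regular.exists_isStationary {σ : M.State → ℕ} (hσ : Regular σ) {ρ : M.State → ℝ}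
    (hρ : IsProb ρ) (ε : ℝ)
    (h : ∀ u : M.State → ℝ, (∀ a ι, Monotone fun q => u (M.st q a ι)) →
      ε * (ρ ⬝ᵥ u) ≤ ε * (ρ ⬝ᵥ ((detPolicy σ hσ.feasible).kernel *ᵥ u))) :
    ∃ ρ', IsStationary (detPolicy σ hσ.feasible) ρ' ∧ ε * (ρ ⬝ᵥ queue) ≤ ε * (ρ' ⬝ᵥ queue) := by
  have hit : ∀ (n : ℕ) (u : M.State → ℝ), (∀ a ι, Monotone fun q => u (M.st q a ι)) →
      ε * (ρ ⬝ᵥ u) ≤ ε * (ρ ⬝ᵥ (fun v => (detPolicy σ hσ.feasible).kernel *ᵥ v)^[n] u) := by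
    intro n
    induction n with
    | zero => exact fun u _ => le_rfl
    | succ n ih =>
      intro u hu
      rw [Function.iterate_succ_apply]
      exact (h u hu).trans (ih _ fun a ι => hσ.mulVec_mono hu a ι)
  have hq : ∀ a ι, Monotone fun q => queue (M := M) (M.st q a ι) := by
    intro a ι q q' hqq
    have : min q Q ≤ min q' Q := by omega
    simp only [queue, st]
    exact_mod_cast this
  obtain ⟨ψ, ρ', hψ, hρ', hlim⟩ := exists_isStationary_tendsto (detPolicy σ hσ.feasible) hρ
  refine ⟨ρ', hρ', ?_⟩
  have h1 : Tendsto (fun k => ε * (cesaro (evolve (detPolicy σ hσ.feasible) ρ) (ψ k) ⬝ᵥ queue))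
      atTop (𝓝 (ε * (ρ' ⬝ᵥ queue))) :=
    (tendsto_finsetSum _ fun x _ => ((tendsto_pi_nhds.1 hlim) x).mul_const _).const_mul ε
  refine ge_of_tendsto h1 ?_
  filter_upwards [eventually_gt_atTop 0] with k hk
  have hk' : (0 : ℝ) < ψ k := by exact_mod_cast hk.trans_le hψ.le_apply
  rw [cesaro_dotProduct, mul_left_comm, Finset.mul_sum, div_mul_eq_mul_div, one_mul,
    le_div_iff₀ hk']
  calc ε * (ρ ⬝ᵥ queue) * (ψ k : ℝ) = ∑ _n ∈ Finset.Icc 1 (ψ k), ε * (ρ ⬝ᵥ queue) := by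
        simp [mul_comm]
    _ ≤ _ := Finset.sum_le_sum fun n _ => by
        rw [evolve_dotProduct]
        exact hit n queue hq

/-- A regular rule that transmits no faster than a policy has the longer average queue. -/
lemma Regular.exists_isStationary_ge {σ : M.State → ℕ} (hσ : Regular σ) {G : M.Policy}
    {ρ : M.State → ℝ} (hρ : IsStationary G ρ) (hle : ∀ x s, ρ x * G.f x s ≠ 0 → σ x ≤ s) :
    ∃ ρ', IsStationary (detPolicy σ hσ.feasible) ρ' ∧ ρ ⬝ᵥ queue ≤ ρ' ⬝ᵥ queue := by
  obtain ⟨ρ', h1, h2⟩ := hσ.exists_isStationary hρ.1 1 fun u hu => by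
    rw [one_mul, one_mul, hρ.dotProduct_eq_sum u, G.dotProduct_eq_sum ρ]
    refine Finset.sum_le_sum fun x _ => Finset.sum_le_sum fun s _ => ?_
    rw [detPolicy_kernel_mulVec]
    by_cases h0 : ρ x * G.f x s = 0
    · rw [h0, zero_mul, zero_mul]
    · have := hle x s h0
      exact mul_le_mul_of_nonneg_left (next_le_next_of_le hu (by omega) _)
        (mul_nonneg (hρ.1.1 x) (G.nonneg x s))
  exact ⟨ρ', h1, by linarith⟩

/-- A regular rule that transmits no slower than a policy has the shorter average queue. -/
lemma Regular.exists_isStationary_le {σ : M.State → ℕ} (hσ : Regular σ) {G : M.Policy}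
    {ρ : M.State → ℝ} (hρ : IsStationary G ρ) (hle : ∀ x s, ρ x * G.f x s ≠ 0 → s ≤ σ x) :
    ∃ ρ', IsStationary (detPolicy σ hσ.feasible) ρ' ∧ ρ' ⬝ᵥ queue ≤ ρ ⬝ᵥ queue := by
  obtain ⟨ρ', h1, h2⟩ := hσ.exists_isStationary hρ.1 (-1) fun u hu => by
    rw [neg_one_mul, neg_one_mul, neg_le_neg_iff, hρ.dotProduct_eq_sum u, G.dotProduct_eq_sum ρ]
    refine Finset.sum_le_sum fun x _ => Finset.sum_le_sum fun s _ => ?_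
    rw [detPolicy_kernel_mulVec]
    by_cases h0 : ρ x * G.f x s = 0
    · rw [h0, zero_mul, zero_mul]
    · have := hle x s h0
      exact mul_le_mul_of_nonneg_left (next_le_next_of_le hu (by omega) _)
        (mul_nonneg (hρ.1.1 x) (G.nonneg x s))
  exact ⟨ρ', h1, by linarith⟩

end FadingLink

namespace FadingLink

variable {Q A S L : ℕ} {M : FadingLink Q A S L}

open Matrix

/-! ### Lagrangian costs -/

/-- Stationary queue length plus `β` times the stationary power. -/
noncomputable def lagrangian (β : ℝ) (G : M.Policy) (ρ : M.State → ℝ) : ℝ :=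
  ρ ⬝ᵥ queue + β * (ρ ⬝ᵥ G.power)

/-- `ρ` is a stationary distribution of `G` of minimal Lagrangian cost. -/
def IsLagrangeOptimal (β : ℝ) (G : M.Policy) (ρ : M.State → ℝ) : Prop :=
  IsStationary G ρ ∧ ∀ (G' : M.Policy) (ρ' : M.State → ℝ), IsStationary G' ρ' → lagrangian β G ρ ≤ lagrangian β G' ρ'

/-- Stationarity cancels `h` against its expected next value, leaving the average Bellman defect,
which is nonnegative when `h` solves the optimality equation. -/
lemma lagrangian_sub {G : M.Policy} {ρ : M.State → ℝ} (hρ : IsStationary G ρ) (β g : ℝ)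
    (h : M.State → ℝ) : lagrangian β G ρ - g = ∑ x, ∑ s ∈ Finset.range (S + 1),
      ρ x * G.f x s * (M.cost β x s + M.next h (x.1 - s) x.2.1 - (g + h x)) := by
  have h1 := hρ.dotProduct_eq_sum h
  have h2 := G.dotProduct_eq_sum ρ h
  have h3 := G.dotProduct_eq_sum ρ queue
  have h4 : g = ∑ x, ∑ s ∈ Finset.range (S + 1), ρ x * G.f x s * g := by
    rw [← G.dotProduct_eq_sum ρ fun _ => g]
    simp only [dotProduct, ← Finset.sum_mul, hρ.1.2, one_mul]
  have h5 : β * (ρ ⬝ᵥ G.power) = ∑ x, ∑ s ∈ Finset.range (S + 1),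
      ρ x * G.f x s * (β * M.P (M.h x.2.2) s) := by
    simp only [dotProduct, Policy.power, Finset.mul_sum]
    exact Finset.sum_congr rfl fun _ _ => Finset.sum_congr rfl fun _ _ => by ring
  have h6 : ∀ (x : M.State) s, ρ x * G.f x s * (M.cost β x s + M.next h (x.1 - s) x.2.1 -
      (g + h x)) = ρ x * G.f x s * queue x + ρ x * G.f x s * (β * M.P (M.h x.2.2) s) +
      ρ x * G.f x s * M.next h (x.1 - s) x.2.1 - (ρ x * G.f x s * g + ρ x * G.f x s * h x) := by
    intro x s
    simp only [cost, queue]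
    ring
  simp only [h6, Finset.sum_add_distrib, Finset.sum_sub_distrib]
  rw [← h1, ← h2, ← h3, ← h4, ← h5, lagrangian]
  ring

lemma Solves.mul_gap_nonneg {β g : ℝ} {h : M.State → ℝ} (H : Solves β g h) {G : M.Policy}
    {ρ : M.State → ℝ} (hρ : IsStationary G ρ) (x : M.State) (s : ℕ) :
    0 ≤ ρ x * G.f x s * (M.cost β x s + M.next h (x.1 - s) x.2.1 - (g + h x)) := by
  by_cases h0 : G.f x s = 0
  · simp [h0]
  · exact mul_nonneg (mul_nonneg (hρ.1.1 x) (G.nonneg x s))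
      (sub_nonneg.2 (H.le (G.feasible h0)))

lemma Solves.le_lagrangian {β g : ℝ} {h : M.State → ℝ} (H : Solves β g h) {G : M.Policy}
    {ρ : M.State → ℝ} (hρ : IsStationary G ρ) : g ≤ lagrangian β G ρ := by
  rw [← sub_nonneg, lagrangian_sub hρ β g h]
  exact Finset.sum_nonneg fun x _ => Finset.sum_nonneg fun s _ => H.mul_gap_nonneg hρ x s

lemma Solves.tight_of_lagrangian_le {β g : ℝ} {h : M.State → ℝ} (H : Solves β g h)
    {G : M.Policy} {ρ : M.State → ℝ} (hρ : IsStationary G ρ) (hle : lagrangian β G ρ ≤ g)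
    {x : M.State} {s : ℕ} (hs : ρ x * G.f x s ≠ 0) : Tight β g h x s := by
  have hf := G.feasible (right_ne_zero_of_mul hs)
  have h1 : lagrangian β G ρ - g = 0 := by linarith [H.le_lagrangian hρ]
  rw [lagrangian_sub hρ β g h] at h1
  have h2 := (Finset.sum_eq_zero_iff_of_nonneg fun x _ => Finset.sum_nonneg fun s _ =>
    H.mul_gap_nonneg hρ x s).1 h1 x (Finset.mem_univ x)
  have h3 := (Finset.sum_eq_zero_iff_of_nonneg fun s _ => H.mul_gap_nonneg hρ x s).1 h2 s
    (Finset.mem_range.2 (by have := hf.2.2; omega))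
  exact ⟨hf, (sub_eq_zero.1 ((mul_eq_zero.1 h3).resolve_left hs)).symm⟩

lemma lagrangian_eq_of_tight {β g : ℝ} {h : M.State → ℝ} {G : M.Policy} {ρ : M.State → ℝ}
    (hρ : IsStationary G ρ) (ht : ∀ x s, G.f x s ≠ 0 → Tight β g h x s) :
    lagrangian β G ρ = g := by
  rw [← sub_eq_zero, lagrangian_sub hρ β g h]
  refine Finset.sum_eq_zero fun x _ => Finset.sum_eq_zero fun s _ => ?_
  by_cases h0 : G.f x s = 0
  · simp [h0]
  · rw [(ht x s h0).2, sub_self, mul_zero]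

lemma tight_of_mixPolicy {β g : ℝ} {h : M.State → ℝ} {σ₀ σ₁ : M.State → ℕ}
    {h₀ : ∀ x, M.Feasible x.1 (σ₀ x)} {h₁ : ∀ x, M.Feasible x.1 (σ₁ x)} {θ : ℝ}
    {hθ : 0 ≤ θ ∧ θ ≤ 1} (ht₀ : ∀ x, Tight β g h x (σ₀ x)) (ht₁ : ∀ x, Tight β g h x (σ₁ x))
    (x : M.State) (s : ℕ) (hs : (mixPolicy σ₀ σ₁ h₀ h₁ θ hθ).f x s ≠ 0) : Tight β g h x s := by
  by_contra hc
  refine hs ?_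
  have h2 : s ≠ σ₀ x := fun h => hc (h ▸ ht₀ x)
  have h3 : s ≠ σ₁ x := fun h => hc (h ▸ ht₁ x)
  simp [mixPolicy, h2, h3]

lemma exists_regular_isLagrangeOptimal {β : ℝ} (hβ : 0 ≤ β) :
    ∃ (σ : M.State → ℕ) (hσ : Regular σ), Unichain (detPolicy σ hσ.feasible) ∧
      ∀ ρ, IsStationary (detPolicy σ hσ.feasible) ρ →
        IsLagrangeOptimal β (detPolicy σ hσ.feasible) ρ := by
  obtain ⟨g, h, H⟩ := exists_bellman_solution (M := M) hβ
  obtain ⟨lo, hi, hlo, -, ht⟩ := Solves.exists_regular hβ H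
  have htlo : ∀ x, Tight β g h x (lo x) := fun x => by
    obtain ⟨s, hs⟩ := Solves.exists_tight H x
    have := (ht x s).1 hs
    exact (ht x _).2 ⟨le_rfl, this.1.trans this.2⟩
  refine ⟨lo, hlo, unichain_mixPolicy hβ hlo hlo htlo htlo _, fun ρ hρ => ⟨hρ, ?_⟩⟩
  intro G' ρ' hρ'
  rw [lagrangian_eq_of_tight hρ (tight_of_mixPolicy htlo htlo)]
  exact Solves.le_lagrangian H hρ'

/-- Along any sequence of power weights, one regular rule is optimal infinitely often. -/
lemma exists_frequently_isLagrangeOptimal {β : ℕ → ℝ} (hβ : ∀ k, 0 ≤ β k) :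
    ∃ (σ : M.State → ℕ) (hσ : Regular σ) (ρ : M.State → ℝ),
      Unichain (detPolicy σ hσ.feasible) ∧ IsStationary (detPolicy σ hσ.feasible) ρ ∧
      ∃ᶠ k in atTop, IsLagrangeOptimal (β k) (detPolicy σ hσ.feasible) ρ := by
  choose σ hσ hun hopt using fun k => exists_regular_isLagrangeOptimal (M := M) (hβ k)
  -- Feasible rates are at most `S`, so there are only finitely many rules and one of them recurs
  -- infinitely often.
  obtain ⟨c, hc⟩ := Finite.exists_infinite_fiber fun k =>
    (fun x => ⟨σ k x, Nat.lt_succ_of_le ((hσ k).feasible x).2.2⟩ : M.State → Fin (S + 1))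
  rw [Set.infinite_coe_iff] at hc
  have hc' : ∀ k l, k ∈ (fun k => (fun x => ⟨σ k x, Nat.lt_succ_of_le ((hσ k).feasible x).2.2⟩ :
      M.State → Fin (S + 1))) ⁻¹' {c} → l ∈ (fun k => (fun x => ⟨σ k x,
      Nat.lt_succ_of_le ((hσ k).feasible x).2.2⟩ : M.State → Fin (S + 1))) ⁻¹' {c} →
      σ k = σ l := by
    intro k l hk hl
    have h1 : _ = c := hk
    have h2 : _ = c := hl
    funext x
    exact congrArg Fin.val (congrFun (h1.trans h2.symm) x)
  obtain ⟨l, hl⟩ := hc.nonempty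
  obtain ⟨x₀⟩ := instNonemptyState (M := M)
  obtain ⟨ρ, hρ⟩ := exists_isStationary (detPolicy (σ l) (hσ l).feasible) x₀
  refine ⟨σ l, hσ l, ρ, hun l, hρ, (Nat.frequently_atTop_iff_infinite.2 hc).mono fun k hk => ?_⟩
  have heq := hc' k l hk hl
  have h1 := hopt k
  simp only [heq] at h1
  exact h1 ρ hρ

/-- For a fixed stationary pair the Lagrangian is affine in the weight, so its optimality
inequalities pass to the limit. -/
lemma isLagrangeOptimal_of_frequently {β : ℕ → ℝ} {b : ℝ} (hβ : Tendsto β atTop (𝓝 b))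
    {G : M.Policy} {ρ : M.State → ℝ} (h : ∃ᶠ k in atTop, IsLagrangeOptimal (β k) G ρ) :
    IsLagrangeOptimal b G ρ := by
  have hlim : ∀ (G : M.Policy) ρ, Tendsto (fun k => lagrangian (β k) G ρ) atTop
      (𝓝 (lagrangian b G ρ)) := fun G ρ => (hβ.mul_const _).const_add _
  obtain ⟨k, hk⟩ := h.exists
  exact ⟨hk.1, fun G' ρ' hρ' => le_of_tendsto_of_tendsto_of_frequently (hlim G ρ) (hlim G' ρ')
    (h.mono fun k hk => hk.2 G' ρ' hρ')⟩

/-- Adding the two optimality inequalities cancels the queue terms and leaves `β' - β` times the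
power difference. -/
lemma IsLagrangeOptimal.power_le {β β' : ℝ} (hlt : β < β') {G G' : M.Policy}
    {ρ ρ' : M.State → ℝ} (h : IsLagrangeOptimal β G ρ) (h' : IsLagrangeOptimal β' G' ρ') :
    ρ' ⬝ᵥ G'.power ≤ ρ ⬝ᵥ G.power := by
  have h1 := h.2 G' ρ' h'.1
  have h2 := h'.2 G ρ h.1
  simp only [lagrangian] at h1 h2
  refine le_of_mul_le_mul_left ?_ (sub_pos.2 hlt)
  linarith

/-! ### Threshold form -/

lemma Regular.mono_fin {σ : M.State → ℕ} (hσ : Regular σ) {q q' : Fin (Q + 1)} (h : q ≤ q')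
    (a ι) : σ (q, a, ι) ≤ σ (q', a, ι) := by
  have h1 := hσ.mono_le (q := q) (q' := q') h (by omega) a ι
  rwa [show M.st q a ι = (q, a, ι) from M.st_self (q, a, ι),
    show M.st q' a ι = (q', a, ι) from M.st_self (q', a, ι)] at h1

/-- The largest queue length in which `σ` transmits at most `s` packets. -/
def threshold (σ : M.State → ℕ) (s : ℤ) (a : Fin (A + 1)) (ι : Fin L) : ℤ :=
  ((Finset.univ.filter fun q : Fin (Q + 1) => (σ (q, a, ι) : ℤ) ≤ s).card : ℤ) - 1

lemma Regular.le_threshold_iff {σ : M.State → ℕ} (hσ : Regular σ) (q : Fin (Q + 1)) (s : ℤ)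
    (a : Fin (A + 1)) (ι : Fin L) : (q : ℤ) ≤ threshold σ s a ι ↔ (σ (q, a, ι) : ℤ) ≤ s := by
  constructor
  · intro h
    by_contra! hc
    have h1 : (Finset.univ.filter fun q : Fin (Q + 1) => (σ (q, a, ι) : ℤ) ≤ s) ⊆
        Finset.Iio q := by
      intro q' hq'
      rw [Finset.mem_filter] at hq'
      rw [Finset.mem_Iio]
      by_contra! hqq
      have := hσ.mono_fin hqq a ι
      omega
    have h2 := Finset.card_le_card h1
    rw [Fin.card_Iio] at h2
    rw [threshold] at h
    omega
  · intro h
    have h1 : Finset.Iic q ⊆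
        (Finset.univ.filter fun q : Fin (Q + 1) => (σ (q, a, ι) : ℤ) ≤ s) := by
      intro q' hq'
      rw [Finset.mem_Iic] at hq'
      have := hσ.mono_fin hq' a ι
      rw [Finset.mem_filter]
      exact ⟨Finset.mem_univ _, by omega⟩
    have h2 := Finset.card_le_card h1
    rw [Fin.card_Iic] at h2
    rw [threshold]
    omega

lemma Regular.isThresholds {σ : M.State → ℕ} (hσ : Regular σ) :
    M.IsThresholds (threshold σ) := by
  refine ⟨fun a ι => ?_, fun a ι => ?_, fun s a ι _ => ?_, fun a ι => ?_⟩
  · rw [threshold, Finset.filter_false_of_mem fun q _ => by omega]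
    simp
  · refine (hσ.le_threshold_iff 0 0 a ι).2 ?_
    have := (hσ.feasible (0, a, ι)).2.1
    simp only [Fin.val_zero] at this
    omega
  · refine sub_le_sub_right (Nat.cast_le.2 (Finset.card_le_card fun q hq => ?_)) _
    rw [Finset.mem_filter] at hq ⊢
    exact ⟨hq.1, by omega⟩
  · have := Finset.card_le_univ (Finset.univ.filter fun q : Fin (Q + 1) => (σ (q, a, ι) : ℤ) ≤ S)
    rw [Fintype.card_fin] at this
    rw [threshold]
    omega

/-- By `hlast`, the queue length of `x` is the last one with its rate under `σ₀`, hence equal to a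
threshold, which is where the definition allows mixing. -/
lemma Regular.isThresholdPolicy {σ₀ σ₁ : M.State → ℕ} (hσ₀ : Regular σ₀)
    (h₁ : ∀ x, M.Feasible x.1 (σ₁ x)) {x : M.State} (hne : ∀ y, y ≠ x → σ₁ y = σ₀ y)
    (hx : σ₁ x = σ₀ x ∨ σ₁ x = σ₀ x + 1) (hlast : ∀ q, x.1 < q → σ₀ x < σ₀ (q, x.2)) (θ : ℝ)
    (hθ : 0 ≤ θ ∧ θ ≤ 1) :
    M.IsThresholdPolicy (mixPolicy σ₀ σ₁ hσ₀.feasible h₁ θ hθ) (threshold σ₀) (σ₀ x) x.2.1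
      x.2.2 := by
  have hmem : ∀ (q : Fin (Q + 1)) a ι (s : ℕ), threshold σ₀ (s - 1) a ι < q →
      (q : ℤ) ≤ threshold σ₀ s a ι → σ₀ (q, a, ι) = s := by
    intro q a ι s h2 h3
    rw [hσ₀.le_threshold_iff] at h3
    rw [← not_le, hσ₀.le_threshold_iff] at h2
    omega
  have hone : ∀ y s, y ≠ x → σ₀ y = s → (mixPolicy σ₀ σ₁ hσ₀.feasible h₁ θ hθ).f y s = 1 := by
    rintro y s hy rfl
    simp [mixPolicy, hne y hy]
  have hstar : ∀ q : Fin (Q + 1), (q : ℤ) = threshold σ₀ (σ₀ x) x.2.1 x.2.2 ↔ q = x.1 := by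
    intro q
    have h2 : (x.1 : ℤ) ≤ threshold σ₀ (σ₀ x) x.2.1 x.2.2 :=
      (hσ₀.le_threshold_iff x.1 _ _ _).2 le_rfl
    have h3 : ∀ q : Fin (Q + 1), (q : ℤ) ≤ threshold σ₀ (σ₀ x) x.2.1 x.2.2 → q ≤ x.1 := by
      intro q hq
      by_contra! hc
      have h4 := (hσ₀.le_threshold_iff q _ _ _).1 hq
      have h5 := hlast q hc
      exact absurd h5 (not_lt.2 (by exact_mod_cast h4))
    have h6 : threshold σ₀ (σ₀ x) x.2.1 x.2.2 = x.1 := by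
      have h8 : threshold σ₀ (σ₀ x) x.2.1 x.2.2 ≤ Q := by
        have := Finset.card_le_univ
          (Finset.univ.filter fun q : Fin (Q + 1) => (σ₀ (q, x.2.1, x.2.2) : ℤ) ≤ σ₀ x)
        rw [Fintype.card_fin] at this
        rw [threshold]
        omega
      have h9 := h3 ⟨(threshold σ₀ (σ₀ x) x.2.1 x.2.2).toNat, by omega⟩
        (by simp only; omega)
      rw [Fin.le_def] at h9
      simp only at h9
      omega
    rw [h6, Fin.ext_iff]
    exact Nat.cast_inj
  refine ⟨?_, ?_, ?_, ?_⟩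
  · intro q a ι s _ hs h2 h3
    have h4 := hmem q a ι s h2 h3
    refine hone _ _ ?_ h4
    rintro rfl
    subst h4
    simp at hs
  · intro q h2 h3
    refine hone _ _ ?_ (hmem q _ _ _ h2 h3.le)
    intro h4
    exact h3.ne ((hstar q).2 (congrArg Prod.fst h4))
  · intro q hq
    rw [hstar] at hq
    subst hq
    change (mixPolicy σ₀ σ₁ hσ₀.feasible h₁ θ hθ).f x _ +
      (mixPolicy σ₀ σ₁ hσ₀.feasible h₁ θ hθ).f x _ = 1
    rcases hx with hx | hx <;> simp [mixPolicy, hx]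
  · intro q a ι s hs h2 h3
    have h4 : σ₀ (q, a, ι) ≠ s := by
      rintro rfl
      refine h2 ⟨?_, (hσ₀.le_threshold_iff _ _ _ _).2 le_rfl⟩
      rw [← not_le, hσ₀.le_threshold_iff]
      omega
    have h5 : σ₁ (q, a, ι) ≠ s := by
      intro h5
      by_cases h6 : (q, a, ι) = x
      · subst h6
        exact h3 ⟨rfl, rfl, (hstar q).2 rfl, by omega⟩
      · exact h4 ((hne _ h6).symm.trans h5)
    simp [mixPolicy, h4.symm, h5.symm]

/-! ### Mixing two neighbouring rules -/

lemma exists_mix_weight {u v t : ℝ} (hu : u ≤ t) (hv : t ≤ v) :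
    ∃ c : ℝ, 0 ≤ c ∧ c ≤ 1 ∧ (1 - c) * u + c * v = t := by
  have h : t ∈ segment ℝ u v := by
    rw [segment_eq_Icc (hu.trans hv)]
    exact ⟨hu, hv⟩
  obtain ⟨a, c, ha, hc, hac, h⟩ := h
  exact ⟨c, hc, by linarith, by simpa [← hac] using h⟩

/-- Every convex combination of stationary distributions of two rules that differ in one state is
stationary for a mixture of the rules. -/
lemma exists_mixPolicy_isStationary {σ₀ σ₁ : M.State → ℕ} (h₀ : ∀ x, M.Feasible x.1 (σ₀ x))
    (h₁ : ∀ x, M.Feasible x.1 (σ₁ x)) {x : M.State} (hne : ∀ y, y ≠ x → σ₁ y = σ₀ y)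
    {ρ₀ ρ₁ : M.State → ℝ} (hρ₀ : IsStationary (detPolicy σ₀ h₀) ρ₀)
    (hρ₁ : IsStationary (detPolicy σ₁ h₁) ρ₁) {c : ℝ} (hc0 : 0 ≤ c) (hc1 : c ≤ 1) :
    ∃ (θ : ℝ) (hθ : 0 ≤ θ ∧ θ ≤ 1) (ρ : M.State → ℝ),
      IsStationary (mixPolicy σ₀ σ₁ h₀ h₁ θ hθ) ρ ∧
      ρ ⬝ᵥ (mixPolicy σ₀ σ₁ h₀ h₁ θ hθ).power =
        (1 - c) * (ρ₀ ⬝ᵥ (detPolicy σ₀ h₀).power) + c * (ρ₁ ⬝ᵥ (detPolicy σ₁ h₁).power) := by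
  have hn0 : ∀ y, 0 ≤ (1 - c) * ρ₀ y := fun y => mul_nonneg (by linarith) (hρ₀.1.1 y)
  have hn1 : ∀ y, 0 ≤ c * ρ₁ y := fun y => mul_nonneg hc0 (hρ₁.1.1 y)
  let ρ : M.State → ℝ := fun y => (1 - c) * ρ₀ y + c * ρ₁ y
  -- The share of the mass at `x` contributed by `ρ₁`. If `ρ x = 0`, division by zero gives 0 and
  -- both contributions vanish.
  let θ : ℝ := c * ρ₁ x / ρ x
  have hρx : 0 ≤ ρ x := add_nonneg (hn0 x) (hn1 x)
  have hθ : 0 ≤ θ ∧ θ ≤ 1 :=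
    ⟨div_nonneg (hn1 x) hρx, div_le_one_of_le₀ (le_add_of_nonneg_left (hn0 x)) hρx⟩
  have hρθ : ρ x * θ = c * ρ₁ x := by
    rcases eq_or_ne (ρ x) 0 with h | h
    · have h2 : (1 - c) * ρ₀ x + c * ρ₁ x = 0 := h
      rw [h, zero_mul]
      linarith [hn0 x, hn1 x]
    · exact mul_div_cancel₀ _ h
  have key : ∀ y (k : ℕ → ℝ), ρ y * ((1 - θ) * k (σ₀ y) + θ * k (σ₁ y)) =
      (1 - c) * (ρ₀ y * k (σ₀ y)) + c * (ρ₁ y * k (σ₁ y)) := by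
    intro y k
    by_cases hy : y = x
    · subst hy
      have h2 : ρ y = (1 - c) * ρ₀ y + c * ρ₁ y := rfl
      linear_combination (k (σ₁ y) - k (σ₀ y)) * hρθ + k (σ₀ y) * h2
    · rw [hne y hy]
      simp only [ρ]
      ring
  have hdet : ∀ (σ : M.State → ℕ) h y z, (detPolicy σ h).kernel y z = M.trans y (σ y) z := by
    intro σ h y z
    refine (sum_mixPolicy_mul y fun s => M.trans y s z).trans ?_
    ring
  refine ⟨θ, hθ, ρ, ⟨⟨fun y => add_nonneg (hn0 y) (hn1 y), ?_⟩, ?_⟩, ?_⟩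
  · simp only [ρ, Finset.sum_add_distrib, ← Finset.mul_sum, hρ₀.1.2, hρ₁.1.2]
    ring
  · funext z
    have h2 := congrFun hρ₀.2 z
    have h3 := congrFun hρ₁.2 z
    simp only [vecMul, dotProduct, hdet] at h2 h3 ⊢
    simp only [Policy.kernel, sum_mixPolicy_mul _ fun s => M.trans _ s z]
    rw [Finset.sum_congr rfl fun y _ => key y fun s => M.trans y s z, Finset.sum_add_distrib,
      ← Finset.mul_sum, ← Finset.mul_sum, h2, h3]
  · simp only [dotProduct, mixPolicy_power, detPolicy_power]
    rw [Finset.sum_congr rfl fun y _ => key y fun s => M.P (M.h y.2.2) s,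
      Finset.sum_add_distrib, ← Finset.mul_sum, ← Finset.mul_sum]

/-! ### The constrained optimum -/

/-- All stationary pairs supported on tight rates have the same Lagrangian cost, so for `β > 0` a
longer queue means less power. Hence the slowest and the fastest tight rule straddle `Pth`, and so
do neighbours on a descending path between them. -/
lemma exists_optimal_of_crossing {β Pth : ℝ} (hβ : 0 < β) {G G' : M.Policy}
    {ρ ρ' : M.State → ℝ} (hG : IsLagrangeOptimal β G ρ) (hG' : IsLagrangeOptimal β G' ρ')
    (hle : ρ ⬝ᵥ G.power ≤ Pth) (hge : Pth ≤ ρ' ⬝ᵥ G'.power) :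
    ∃ (F : M.Policy) (τ : ℤ → Fin (A + 1) → Fin L → ℤ)
      (sStar : ℕ) (aStar : Fin (A + 1)) (ιStar : Fin L),
      (∀ x₀ : M.State, M.IsOptimal Pth x₀ F) ∧
      M.IsThresholds τ ∧ sStar ≤ S ∧ M.IsThresholdPolicy F τ sStar aStar ιStar := by
  classical
  obtain ⟨g, h, H⟩ := exists_bellman_solution (M := M) hβ.le
  obtain ⟨lo, hi, hlo, hhi, ht⟩ := Solves.exists_regular hβ.le H
  have hlohi : ∀ x, lo x ≤ hi x := fun x => by
    obtain ⟨s, hs⟩ := Solves.exists_tight H x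
    have := (ht x s).1 hs
    exact this.1.trans this.2
  have hlag : ∀ (σ : M.State → ℕ) (hσ : Regular σ), (∀ x, lo x ≤ σ x ∧ σ x ≤ hi x) →
      ∀ μ, IsStationary (detPolicy σ hσ.feasible) μ →
      lagrangian β (detPolicy σ hσ.feasible) μ = g := fun σ hσ hb μ hμ =>
    lagrangian_eq_of_tight hμ
      (tight_of_mixPolicy (fun x => (ht _ _).2 (hb x)) fun x => (ht _ _).2 (hb x))
  have hopt_eq : ∀ (G : M.Policy) ρ, IsLagrangeOptimal β G ρ → lagrangian β G ρ = g := by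
    intro G ρ hG
    obtain ⟨x₀⟩ := instNonemptyState (M := M)
    obtain ⟨μ, hμ⟩ := exists_isStationary (detPolicy lo hlo.feasible) x₀
    refine le_antisymm ?_ (Solves.le_lagrangian H hG.1)
    rw [← hlag lo hlo (fun x => ⟨le_rfl, hlohi x⟩) μ hμ]
    exact hG.2 _ _ hμ
  have hsupp : ∀ (G : M.Policy) ρ, IsLagrangeOptimal β G ρ → ∀ x s, ρ x * G.f x s ≠ 0 →
      lo x ≤ s ∧ s ≤ hi x := fun G ρ hG x s hs =>
    (ht x s).1 (Solves.tight_of_lagrangian_le H hG.1 (hopt_eq G ρ hG).le hs)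
  obtain ⟨μlo, hμlo, hDlo⟩ := hlo.exists_isStationary_ge hG.1 fun x s hs => (hsupp G ρ hG x s hs).1
  obtain ⟨μhi, hμhi, hDhi⟩ := hhi.exists_isStationary_le hG'.1
    fun x s hs => (hsupp G' ρ' hG' x s hs).2
  have hPlo : μlo ⬝ᵥ (detPolicy lo hlo.feasible).power ≤ Pth := by
    have h1 := hlag lo hlo (fun x => ⟨le_rfl, hlohi x⟩) μlo hμlo
    have h2 := hopt_eq G ρ hG
    rw [lagrangian] at h1 h2
    refine le_trans (le_of_mul_le_mul_left ?_ hβ) hle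
    linarith
  have hPhi : Pth ≤ μhi ⬝ᵥ (detPolicy hi hhi.feasible).power := by
    have h1 := hlag hi hhi (fun x => ⟨hlohi x, le_rfl⟩) μhi hμhi
    have h2 := hopt_eq G' ρ' hG'
    rw [lagrangian] at h1 h2
    refine le_trans hge (le_of_mul_le_mul_left ?_ hβ)
    linarith
  -- Take a regular tight rule of least total rate whose power still reaches `Pth`; lowering it
  -- further in one state must bring the power below `Pth`.
  obtain ⟨σ, ⟨hσ, hb, μ, hμ, hPμ⟩, hmin⟩ := WellFounded.has_min
    (measure fun σ : M.State → ℕ => ∑ x, σ x).wf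
    {σ | ∃ hσ : Regular σ, (∀ x, lo x ≤ σ x ∧ σ x ≤ hi x) ∧
      ∃ μ, IsStationary (detPolicy σ hσ.feasible) μ ∧
        Pth ≤ μ ⬝ᵥ (detPolicy σ hσ.feasible).power}
    ⟨hi, hhi, fun x => ⟨hlohi x, le_rfl⟩, μhi, hμhi, hPhi⟩
  obtain ⟨σ₀, hσ₀, μ₀, x, hb₀, hμ₀, hP₀, hne, hx, hlast⟩ :
      ∃ (σ₀ : M.State → ℕ) (hσ₀ : Regular σ₀) (μ₀ : M.State → ℝ) (x : M.State),
        (∀ x, lo x ≤ σ₀ x ∧ σ₀ x ≤ hi x) ∧ IsStationary (detPolicy σ₀ hσ₀.feasible) μ₀ ∧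
        μ₀ ⬝ᵥ (detPolicy σ₀ hσ₀.feasible).power ≤ Pth ∧ (∀ y, y ≠ x → σ y = σ₀ y) ∧
        (σ x = σ₀ x ∨ σ x = σ₀ x + 1) ∧ ∀ q, x.1 < q → σ₀ x < σ₀ (q, x.2) := by
    by_cases hσlo : lo = σ
    · subst hσlo
      obtain ⟨x₀⟩ := instNonemptyState (M := M)
      -- When `σ` is already `lo`, no state needs lowering. A full-buffer state is used because the
      -- requirement on longer queues is then vacuous.
      exact ⟨lo, hlo, μlo, (Fin.last Q, x₀.2), hb, hμlo, hPlo, fun _ _ => rfl, .inl rfl,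
        fun q hq => absurd hq (not_lt.2 (Fin.le_last q))⟩
    · obtain ⟨x, hx, hreg⟩ := hlo.exists_lower hσ (fun x => (hb x).1) hσlo
      have hself : Function.update σ x (σ x - 1) x = σ x - 1 := Function.update_self ..
      have hother : ∀ y, y ≠ x → Function.update σ x (σ x - 1) y = σ y := fun y hy =>
        Function.update_of_ne hy ..
      have hbu : ∀ y, lo y ≤ Function.update σ x (σ x - 1) y ∧
          Function.update σ x (σ x - 1) y ≤ hi y := by
        intro y
        by_cases hy : y = x
        · subst hy
          rw [hself]
          have := (hb y).2
          omega
        · rw [hother y hy]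
          exact hb y
      obtain ⟨μ₀, hμ₀⟩ := exists_isStationary (detPolicy _ hreg.feasible) x
      refine ⟨_, hreg, μ₀, x, hbu, hμ₀, ?_, fun y hy => (hother y hy).symm, .inr ?_, ?_⟩
      · by_contra! hc
        refine hmin _ ⟨hreg, hbu, μ₀, hμ₀, hc.le⟩ ?_
        change ∑ y, Function.update σ x (σ x - 1) y < ∑ y, σ y
        refine Finset.sum_lt_sum (fun y _ => ?_) ⟨x, Finset.mem_univ x, ?_⟩
        · by_cases hy : y = x
          · subst hy
            rw [hself]
            omega
          · rw [hother y hy]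
        · rw [hself]
          omega
      · rw [hself]
        omega
      · intro q hq
        rw [hself, hother _ fun hc => hq.ne' (congrArg Prod.fst hc)]
        have := hσ.mono_fin hq.le x.2.1 x.2.2
        change σ x ≤ σ (q, x.2) at this
        omega
  obtain ⟨c, hc0, hc1, hc⟩ := exists_mix_weight hP₀ hPμ
  obtain ⟨θ, hθ, π, hπ, hPπ⟩ :=
    exists_mixPolicy_isStationary hσ₀.feasible hσ.feasible hne hμ₀ hμ hc0 hc1
  rw [hc] at hPπ
  have ht₀ : ∀ x, Tight β g h x (σ₀ x) := fun x => (ht _ _).2 (hb₀ x)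
  have ht₁ : ∀ x, Tight β g h x (σ x) := fun x => (ht _ _).2 (hb x)
  refine ⟨mixPolicy σ₀ σ hσ₀.feasible hσ.feasible θ hθ, threshold σ₀, σ₀ x, x.2.1, x.2.2,
    (unichain_mixPolicy hβ.le hσ₀ hσ ht₀ ht₁ hθ).isOptimal hπ hPπ.le fun K ν hν hPν => ?_,
    hσ₀.isThresholds, (hσ₀.feasible x).2.2,
    hσ₀.isThresholdPolicy hσ.feasible hne hx hlast θ hθ⟩
  have h1 := lagrangian_eq_of_tight hπ (tight_of_mixPolicy ht₀ ht₁)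
  have h2 := Solves.le_lagrangian H hν
  rw [lagrangian] at h1 h2
  rw [hPπ] at h1
  have h3 := mul_le_mul_of_nonneg_left hPν hβ.le
  linarith

/-- If minimal Lagrangian costs with power at most `Pth` occur for all small power weights, a
deterministic rule is optimal. -/
lemma exists_optimal_of_forall {Pth : ℝ} (hgood : ∀ β : ℝ, 0 < β → ∃ (G : M.Policy)
      (ρ : M.State → ℝ), IsLagrangeOptimal β G ρ ∧ ρ ⬝ᵥ G.power ≤ Pth) :
    ∃ (F : M.Policy) (τ : ℤ → Fin (A + 1) → Fin L → ℤ)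
      (sStar : ℕ) (aStar : Fin (A + 1)) (ιStar : Fin L),
      (∀ x₀ : M.State, M.IsOptimal Pth x₀ F) ∧
      M.IsThresholds τ ∧ sStar ≤ S ∧ M.IsThresholdPolicy F τ sStar aStar ιStar := by
  have hpos : ∀ k : ℕ, 0 < 1 / ((k : ℝ) + 1) := fun k => by positivity
  obtain ⟨σ, hσ, ρ, hun, hρ, hfreq⟩ :=
    exists_frequently_isLagrangeOptimal (M := M) fun k => (hpos k).le
  have h0 := isLagrangeOptimal_of_frequently tendsto_one_div_add_atTop_nhds_zero_nat hfreq
  obtain ⟨k, hk⟩ := hfreq.exists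
  -- A strictly smaller price is needed for `power_le`; the optimal pair there is within the budget,
  -- and power only falls as the price rises.
  obtain ⟨G, μ, hG, hP⟩ := hgood _ (half_pos (hpos k))
  obtain ⟨x₀⟩ := instNonemptyState (M := M)
  refine ⟨detPolicy σ hσ.feasible, threshold σ, σ (Fin.last Q, x₀.2), x₀.2.1, x₀.2.2,
    hun.isOptimal hρ ((hG.power_le (half_lt_self (hpos k)) hk).trans hP) fun K ν hν _ => ?_,
    hσ.isThresholds, (hσ.feasible _).2.2,
    hσ.isThresholdPolicy hσ.feasible (x := (Fin.last Q, x₀.2)) (fun _ _ => rfl) (.inl rfl)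
      (fun q hq => absurd hq (not_lt.2 (Fin.le_last q))) _ _⟩
  have := h0.2 K ν hν
  simpa [lagrangian] using this

/-- The least average power is attained by a minimizer of the Lagrangian cost for some finite
power weight. -/
lemma exists_isLagrangeOptimal_power_le {F : M.Policy} {ρ : M.State → ℝ}
    (hρ : IsStationary F ρ) : ∃ β : ℝ, 0 < β ∧ ∃ (G : M.Policy) (μ : M.State → ℝ),
      IsLagrangeOptimal β G μ ∧ μ ⬝ᵥ G.power ≤ ρ ⬝ᵥ F.power := by
  have hpos : ∀ k : ℕ, 0 < (k : ℝ) + 1 := fun k => by positivity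
  obtain ⟨σ, hσ, μ, -, hμ, hfreq⟩ :=
    exists_frequently_isLagrangeOptimal (M := M) fun k => (hpos k).le
  obtain ⟨k, hk⟩ := hfreq.exists
  refine ⟨_, hpos k, _, μ, hk, ?_⟩
  by_contra! hc
  -- The same pair is optimal at arbitrarily large prices; an excess of power would eventually
  -- outweigh the fixed difference in queue length.
  obtain ⟨n, hn⟩ := Archimedean.arch (ρ ⬝ᵥ queue - μ ⬝ᵥ queue) (sub_pos.2 hc)
  obtain ⟨l, hl, hl'⟩ := (hfreq.and_eventually (eventually_ge_atTop n)).exists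
  have h1 := hl.2 F ρ hρ
  rw [nsmul_eq_mul] at hn
  have h2 : (n : ℝ) ≤ l := by exact_mod_cast hl'
  have h3 := mul_le_mul_of_nonneg_right h2 (sub_pos.2 hc).le
  simp only [lagrangian] at h1
  linarith

end FadingLink

/-! ### The critical power weight -/

open FadingLink in
theorem theorem8 (Q A S L : ℕ) (M : FadingLink Q A S L) (Pth : ℝ)
    (hPth : ∃ (x₀ : M.State) (F : M.Policy) (p : ℝ), M.HasAvgPower F x₀ p ∧ p ≤ Pth) :
    ∃ (F : M.Policy) (τ : ℤ → Fin (A + 1) → Fin L → ℤ)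
      (sStar : ℕ) (aStar : Fin (A + 1)) (ιStar : Fin L),
      (∀ x₀ : M.State, M.IsOptimal Pth x₀ F) ∧
      M.IsThresholds τ ∧ sStar ≤ S ∧ M.IsThresholdPolicy F τ sStar aStar ιStar := by
  obtain ⟨x₀, F₀, p, hp, hpP⟩ := hPth
  obtain ⟨ρ₀, hρ₀, hpow, -⟩ := exists_isStationary_of_hasAvg F₀ x₀
  let good : Set ℝ := {β | 0 < β ∧ ∃ (G : M.Policy) (ρ : M.State → ℝ),
    IsLagrangeOptimal β G ρ ∧ dotProduct ρ G.power ≤ Pth}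
  obtain ⟨β₁, hβ₁, G₁, μ₁, hG₁, hP₁⟩ := exists_isLagrangeOptimal_power_le hρ₀
  rw [hpow p hp] at hP₁
  have hne : good.Nonempty := ⟨β₁, hβ₁, G₁, μ₁, hG₁, hP₁.trans hpP⟩
  by_cases hall : ∀ β : ℝ, 0 < β → β ∈ good
  · exact exists_optimal_of_forall fun β hβ => (hall β hβ).2
  push Not at hall
  obtain ⟨β₀, hβ₀, hbad⟩ := hall
  -- Above a good price every optimal pair meets the budget, not just one of them; thus `good` is
  -- closed upwards and a bad price bounds it below.
  have hfull : ∀ β ∈ good, ∀ β', β < β' → ∀ (G : M.Policy) (ρ : M.State → ℝ),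
      IsLagrangeOptimal β' G ρ → dotProduct ρ G.power ≤ Pth := by
    rintro β ⟨-, G', ρ', hG', hP'⟩ β' hlt G ρ hG
    exact (hG'.power_le hlt hG).trans hP'
  have hlb : ∀ β ∈ good, β₀ ≤ β := by
    intro β hβ
    by_contra! hc
    obtain ⟨σ, hσ, -, hopt⟩ := exists_regular_isLagrangeOptimal (M := M) hβ₀.le
    obtain ⟨μ, hμ⟩ := exists_isStationary (detPolicy σ hσ.feasible) x₀
    exact hbad ⟨hβ₀, _, μ, hopt μ hμ, hfull β hβ β₀ hc _ _ (hopt μ hμ)⟩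
  have hbdd : BddBelow good := ⟨β₀, hlb⟩
  set b := sInf good
  have hb : 0 < b := hβ₀.trans_le (le_csInf hne hlb)
  have hinv : Tendsto (fun k : ℕ => b * (1 / ((k : ℝ) + 1))) atTop (𝓝 0) := by
    simpa using (tendsto_one_div_add_atTop_nhds_zero_nat (𝕜 := ℝ)).const_mul b
  have hpos : ∀ k : ℕ, 0 < b * (1 / ((k : ℝ) + 1)) := fun k => by positivity
  have hlt : ∀ k : ℕ, b * (1 / ((k : ℝ) + 1)) ≤ b := fun k => by
    refine mul_le_of_le_one_right hb.le ((div_le_one (by positivity)).2 ?_)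
    linarith [(Nat.cast_nonneg k : (0 : ℝ) ≤ k)]
  have hup : Tendsto (fun k : ℕ => b + b * (1 / ((k : ℝ) + 1))) atTop (𝓝 b) := by
    simpa using hinv.const_add b
  -- The perturbation is halved so that the price stays positive at `k = 0`.
  have hdown : Tendsto (fun k : ℕ => b - b * (1 / ((k : ℝ) + 1)) / 2) atTop (𝓝 b) := by
    simpa using (hinv.div_const 2).const_sub b
  have hdpos : ∀ k : ℕ, 0 < b - b * (1 / ((k : ℝ) + 1)) / 2 := fun k => by
    linarith [hlt k]
  obtain ⟨σ, hσ, ρ, -, -, hfreq⟩ := exists_frequently_isLagrangeOptimal (M := M)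
    (β := fun k : ℕ => b + b * (1 / ((k : ℝ) + 1))) fun k => by linarith [hpos k]
  obtain ⟨σ', hσ', ρ', -, -, hfreq'⟩ := exists_frequently_isLagrangeOptimal (M := M)
    (β := fun k : ℕ => b - b * (1 / ((k : ℝ) + 1)) / 2) fun k => (hdpos k).le
  -- Limits of optimal pairs from above and from below are both optimal at `b`. The first has power
  -- at most `Pth`; the second exceeds it, since no price below the infimum is good.
  refine exists_optimal_of_crossing hb (isLagrangeOptimal_of_frequently hup hfreq)
    (isLagrangeOptimal_of_frequently hdown hfreq') ?_ ?_
  · obtain ⟨k, hk⟩ := hfreq.exists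
    obtain ⟨β, hβ, hlt⟩ := exists_lt_of_csInf_lt hne
      (show sInf good < b + b * (1 / ((k : ℝ) + 1)) by linarith [hpos k])
    exact hfull β hβ _ hlt _ _ hk
  · obtain ⟨k, hk⟩ := hfreq'.exists
    by_contra! hc
    have := csInf_le hbdd (show b - b * (1 / ((k : ℝ) + 1)) / 2 ∈ good from
      ⟨hdpos k, _, ρ', hk, hc.le⟩)
    linarith [hpos k]
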